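/- **Setting.** Vehicles $n\in\mathcal N=\{1,\dots,N\}$ travel on a one-lane segment from location $0$ to location $L$, with speed limit $\bar v>0$, acceleration limits $\underline a<0<\bar a$, jam spacing $s>0$ and communication delay $\tau\ge 0$. The signal at $L$ is green at the times $\mathcal G=\bigcup_{m\ge 0}[mC,mC+G)$, where $C=G+R$, $G>0$, $R\ge 0$; let $G(t)=\min\{t'\in\mathcal G: t'\ge t\}$. Vehicle $n$ enters (location $0$) at time $t_n^-$ with speed $v_n^-\in[0,\bar v]$, and $t_1^-<\dots<t_N^-$. A *trajectory* is a differentiable $p:\mathbb R\to\mathbb R$ whose velocity $\dot p$ is locally absolutely continuous and right-differentiable everywhere, with acceleration $\ddot p$ (the right derivative of $\dot p$) Riemann integrable on bounded intervals. $\mathcal T$ is the set of trajectories with $0\le\dot p\le\bar v$ and $\underline a\le\ddot p\le\bar a$ everywhere. Put $p^{-1}(L)=\inf\{t:p(t)\ge L\}$ and $p^{\rm s}(t)=p(t-\tau)-s$ (the shadow of $p$). $\mathcal P$ is the set of vectors $(p_n)_{n\in\mathcal N}$ in $\mathcal T$ such that $p_n(t_n^-)=0$ and $\dot p_n(t_n^-)=v_n^-$;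 $p_n$ reaches $L$ and $p_n^{-1}(L)\in\mathcal G$; and $p_n(t)\le p_{n-1}^{\rm s}(t)$ for all $t\ge t_n^-$ and $n\ge2$ (what precedes entry is regarded as given history: a trajectory is identified with its section from the entry time on). $\hat{\mathcal P}$ is the set of $(p_n)\in\mathcal P$ with $\dot p_n(p_n^{-1}(L))=\bar v$ for all $n$. **Shooting heuristic** $P^{\rm SH}(\underline a,\bar a,\underline a,\bar a)$. *Forward shooting* from a state (location $l$, speed $v$, time $t_0$) below a bound $u$: the template accelerates at $\bar a$ up to speed $\bar v$ and then cruises. If the parabola with deceleration $\underline a$ started at $t_0$ exceeds $u$ somewhere on $[t_0,\infty)$, the process fails. Otherwise, if there are $t_0\le t^{\rm m}\le t^+$ such that the template on $[t_0,t^{\rm m}]$ and the parabola with deceleration $\underline a$ leaving it at $t^{\rm m}$ (extended to $\infty$) stay below $u$ and this parabola is tangent to $u$ at $t^+$, follow the template up to $t^{\rm m}$, the parabola up to $t^+$, then $u$. Otherwise, or if there is no bound, follow the template. *Backward shooting* from $(l,v,t_0)$ to a section $p^{\rm f}$ starting at time $t_1$: the backward template, read backwards in time from $t_0$, decelerates at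 rate $\bar a$ to a standstill and then stays. Look for $t_1\le t^+\le t^{\rm m}\le t_0$ such that the template on $[t^{\rm m},t_0]$ and the parabola of acceleration $\underline a$ meeting the template at $t^{\rm m}$ with the same speed (extended backwards to $t_1$) stay below $p^{\rm f}$ and this parabola is tangent to $p^{\rm f}$ at $t^+$. If there are none, the process fails. Otherwise follow $p^{\rm f}$ up to $t^+$, the parabola up to $t^{\rm m}$, the template up to $t_0$, and then the forward shooting from $(l,v,t_0)$ below $p^{\rm f}$. For $n=1,\dots,N$ let $p_n^{\rm f}$ be the forward shooting from $(0,v_n^-,t_n^-)$ below $p_{n-1}^{\rm s}$ (no bound if $n=1$), and let $t_n^L$ be the time at which it reaches $L$. If $t_n^L\in\mathcal G$, put $p_n=p_n^{\rm f}$; otherwise let $p_n$ be the backward shooting from $(L,\dot p_n^{\rm f}(t_n^L),G(t_n^L))$ to $p_n^{\rm f}$, whose merging point must have location $\ge 0$. If a process fails for some vehicle, $P^{\rm SH}=\emptyset$; otherwise $P^{\rm SH}=(p_n)_{n\in\mathcal N}$. **Theorem.** Assume $L\ge \bar v^2/(2\bar a)$. Then $\hat{\mathcal P}\neq\emptyset$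 if and only if $P^{\rm SH}(\underline a,\bar a,\underline a,\bar a)\neq\emptyset$. Moreover, if $P^{\rm SH}(\underline a,\bar a,\underline a,\bar a)=(p_n)_{n\in\mathcal N}$, then for every $(p'_n)\in\hat{\mathcal P}$, every $n\in\mathcal N$ and every $t\ge t_n^-$ one has $p'_n(t)\le p_n(t)$. -/

import Mathlib

noncomputable section

namespace SignalTraj

/-! ### Trajectories and the feasible sets -/

/-- Physical data: segment length `L`, green duration `G`, red duration `R`, speed limit `vMax`,
deceleration limit `aMin` (negative), acceleration limit `aMax`, jam spacing `s`,
communication delay `τ`. -/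
structure Setting where
  L : ℝ
  G : ℝ
  R : ℝ
  vMax : ℝ
  aMin : ℝ
  aMax : ℝ
  s : ℝ
  τ : ℝ

/-- Acceleration: the right derivative of the velocity. -/
def accel (p : ℝ → ℝ) (t : ℝ) : ℝ := derivWithin (deriv p) (Set.Ici t) t

/-- Riemann integrability on every bounded interval (boxes in `Fin 1 → ℝ` are bounded intervals). -/
def LocallyRiemannIntegrable (f : ℝ → ℝ) : Prop :=
  ∀ I : BoxIntegral.Box (Fin 1),
    BoxIntegral.Integrable I BoxIntegral.IntegrationParams.Riemann
      (fun x : Fin 1 → ℝ => f (x 0)) (BoxIntegral.BoxAdditiveMap.volume (E := ℝ))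

/-- A trajectory: differentiable, with (locally) absolutely continuous velocity, everywhere
right-differentiable velocity, and Riemann integrable acceleration. -/
structure IsTrajectory (p : ℝ → ℝ) : Prop where
  differentiable : Differentiable ℝ p
  velocity_ac : ∀ a b : ℝ, AbsolutelyContinuousOnInterval (deriv p) a b
  velocity_rightDiff : ∀ t : ℝ, DifferentiableWithinAt ℝ (deriv p) (Set.Ici t) t
  accel_integrable : LocallyRiemannIntegrable (accel p)

/-- Kinematically feasible trajectories. -/
def kinematic (S : Setting) : Set (ℝ → ℝ) :=
  {p | IsTrajectory p ∧ ∀ t : ℝ, (0 ≤ deriv p t ∧ deriv p t ≤ S.vMax) ∧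
    (S.aMin ≤ accel p t ∧ accel p t ≤ S.aMax)}

/-- The set of green times: the union over `m = 0, 1, 2, …` of `[m C, m C + G)`, `C = G + R`. -/
def greenTimes (S : Setting) : Set ℝ :=
  {t | ∃ m : ℕ, (m : ℝ) * (S.G + S.R) ≤ t ∧ t < (m : ℝ) * (S.G + S.R) + S.G}

/-- The earliest green time not before `t`. -/
def nextGreen (S : Setting) (t : ℝ) : ℝ := sInf {t' | t' ∈ greenTimes S ∧ t ≤ t'}

/-- Generalized inverse: the first time at which location `l` is reached. -/
def passTime (p : ℝ → ℝ) (l : ℝ) : ℝ := sInf {t | l ≤ p t}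

/-- Entry boundary condition: location `0` with speed `v` at time `t`. -/
def entrySet (S : Setting) (v t : ℝ) : Set (ℝ → ℝ) :=
  {p | p ∈ kinematic S ∧ p t = 0 ∧ deriv p t = v}

/-- Exit boundary condition: location `L` is reached, and first reached at a green time. -/
def exitSet (S : Setting) : Set (ℝ → ℝ) :=
  {p | p ∈ kinematic S ∧ (∃ t, S.L ≤ p t) ∧ passTime p S.L ∈ greenTimes S}

/-- The shadow (safety bound) of a trajectory. -/
def shadow (S : Setting) (p : ℝ → ℝ) (t : ℝ) : ℝ := p (t - S.τ) - S.s

/-- Feasible trajectory vectors. The safety constraint on a follower applies from its own entry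
time on: what precedes the entry is given history, a trajectory being identified with its section
from the entry time. -/
def feasible (S : Setting) {N : ℕ} (v t : Fin N → ℝ) : Set (Fin N → ℝ → ℝ) :=
  {p | (∀ n, p n ∈ entrySet S (v n) (t n) ∧ p n ∈ exitSet S) ∧
    ∀ m n : Fin N, (m : ℕ) + 1 = n → ∀ x : ℝ, t n ≤ x → p n x ≤ shadow S (p m) x}

/-- Feasible trajectory vectors in which every vehicle exits at the speed limit. -/
def feasibleFullSpeed (S : Setting) {N : ℕ} (v t : Fin N → ℝ) : Set (Fin N → ℝ → ℝ) :=
  {p | p ∈ feasible S v t ∧ ∀ n, deriv (p n) (passTime (p n) S.L) = S.vMax}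

/-! ### The shooting heuristic

The four control parameters are the forward deceleration `dF`, forward acceleration `aF`,
backward deceleration `dB` and backward acceleration `aB`. -/

/-- The quadratic function `(l, v, a, t₀)`: location `l` and speed `v` at time `t₀`,
acceleration `a`. -/
def quad (l v a t₀ t : ℝ) : ℝ := a / 2 * (t - t₀) ^ 2 + v * (t - t₀) + l

/-- Speed along the forward template: accelerate at `aF` up to `vMax`, then cruise. -/
def fwdSpeed (S : Setting) (aF v t₀ t : ℝ) : ℝ := min S.vMax (v + aF * (t - t₀))

/-- Forward template from `(l, v, t₀)`. Before `t₀` a constant-speed history is attached, so that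
the function is a trajectory on the whole time axis. -/
def fwdTemplate (S : Setting) (aF l v t₀ t : ℝ) : ℝ :=
  if t ≤ t₀ then quad l v 0 t₀ t
  else if t ≤ t₀ + (S.vMax - v) / aF then quad l v aF t₀ t
  else quad (l + (S.vMax ^ 2 - v ^ 2) / (2 * aF)) S.vMax 0 (t₀ + (S.vMax - v) / aF) t

/-- Extended forward merging segment: leaves the forward template at time `tm`, deceleration `dF`. -/
def fwdMergeSeg (S : Setting) (dF aF l v t₀ tm t : ℝ) : ℝ :=
  quad (fwdTemplate S aF l v t₀ tm) (fwdSpeed S aF v t₀ tm) dF tm t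

/-- The template followed up to `tm` and the merging segment extended from `tm` to infinity stay
below `u`, and the merging segment is tangent to `u` at `tp`. -/
def IsFwdMerge (S : Setting) (dF aF l v t₀ : ℝ) (u : ℝ → ℝ) (tm tp : ℝ) : Prop :=
  t₀ ≤ tm ∧ tm ≤ tp ∧
  (∀ t, t₀ ≤ t → t ≤ tm → fwdTemplate S aF l v t₀ t ≤ u t) ∧
  (∀ t, tm ≤ t → fwdMergeSeg S dF aF l v t₀ tm t ≤ u t) ∧
  fwdMergeSeg S dF aF l v t₀ tm tp = u tp ∧
  fwdSpeed S aF v t₀ tm + dF * (tp - tm) = deriv u tp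

open Classical in
/-- Forward shooting process from the state point `(l, v, t₀)` below the bound `u` (`none`: no
bound). Case I: even immediate deceleration at `dF` crosses `u`, the process fails. Case II: follow
the template, then the merging segment, then `u`. Case III: no tangency, follow the template. -/
def forwardShooting (S : Setting) (dF aF : ℝ) (l v t₀ : ℝ) :
    Option (ℝ → ℝ) → Option (ℝ → ℝ)
  | none => some (fwdTemplate S aF l v t₀)
  | some u =>
    if ¬ ∀ t, t₀ ≤ t → quad l v dF t₀ t ≤ u t then none
    else if h : ∃ m : ℝ × ℝ, IsFwdMerge S dF aF l v t₀ u m.1 m.2 then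
      some fun t =>
        if t ≤ h.choose.1 then fwdTemplate S aF l v t₀ t
        else if t ≤ h.choose.2 then fwdMergeSeg S dF aF l v t₀ h.choose.1 t
        else u t
    else some (fwdTemplate S aF l v t₀)

/-- Speed along the backward template: `aB` after a standstill. -/
def bwdSpeed (aB v t₀ t : ℝ) : ℝ := max 0 (v - aB * (t₀ - t))

/-- Backward template from `(l, v, t₀)`: backwards in time, decelerate at rate `aB` to a
standstill, then stay there. -/
def bwdTemplate (aB l v t₀ t : ℝ) : ℝ :=
  if t₀ - v / aB ≤ t then quad l v aB t₀ t else l - v ^ 2 / (2 * aB)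

/-- Backward merging segment with deceleration `dB`, ending on the backward template at `tm`. -/
def bwdMergeSeg (dB aB l v t₀ tm t : ℝ) : ℝ :=
  quad (bwdTemplate aB l v t₀ tm) (bwdSpeed aB v t₀ tm) dB tm t

/-- `pf` is a trajectory section starting at time `t₁`. The template on `[tm, t₀]` and the merging
segment extended backwards from `tm` stay below `pf`, and the merging segment is tangent to `pf`
at `tp`. -/
def IsBwdMerge (dB aB l v t₀ t₁ : ℝ) (pf : ℝ → ℝ) (tm tp : ℝ) : Prop :=
  t₁ ≤ tp ∧ tp ≤ tm ∧ tm ≤ t₀ ∧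
  (∀ t, tm ≤ t → t ≤ t₀ → bwdTemplate aB l v t₀ t ≤ pf t) ∧
  (∀ t, t₁ ≤ t → t ≤ tm → bwdMergeSeg dB aB l v t₀ tm t ≤ pf t) ∧
  bwdMergeSeg dB aB l v t₀ tm tp = pf tp ∧
  bwdSpeed aB v t₀ tm + dB * (tp - tm) = deriv pf tp

open Classical in
/-- Backward shooting process from `(l, v, t₀)` to the section `pf` starting at `t₁`. It returns
the start location of the backward section together with the extended backward shooting
trajectory: `pf`, the merging segment, the backward template, and from `t₀` on an auxiliary
forward shooting below `pf`. -/
def backwardShooting (S : Setting) (dF aF dB aB : ℝ) (l v t₀ t₁ : ℝ) (pf : ℝ → ℝ) :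
    Option (ℝ × (ℝ → ℝ)) :=
  if h : ∃ m : ℝ × ℝ, IsBwdMerge dB aB l v t₀ t₁ pf m.1 m.2 then
    (forwardShooting S dF aF l v t₀ (some pf)).map fun aux =>
      (pf h.choose.2, fun t =>
        if t ≤ h.choose.2 then pf t
        else if t ≤ h.choose.1 then bwdMergeSeg dB aB l v t₀ h.choose.1 t
        else if t ≤ t₀ then bwdTemplate aB l v t₀ t
        else aux t)
  else none

open Classical in
/-- One step of the heuristic, for a vehicle with entry speed `v` and entry time `t₁`, given the
trajectory already constructed for its predecessor (`none` for the lead vehicle). -/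
def shStep (S : Setting) (dF aF dB aB : ℝ) (v t₁ : ℝ) (prev : Option (ℝ → ℝ)) :
    Option (ℝ → ℝ) :=
  (forwardShooting S dF aF 0 v t₁ (prev.map (shadow S))).bind fun pf =>
    if passTime pf S.L ∈ greenTimes S then some pf
    else
      (backwardShooting S dF aF dB aB S.L (deriv pf (passTime pf S.L))
          (nextGreen S (passTime pf S.L)) t₁ pf).bind fun b =>
        if 0 ≤ b.1 then some b.2 else none

/-- The trajectory that the heuristic constructs for vehicle `n` (vehicles are numbered from `0`),
or `none` if it fails at this vehicle or at an earlier one. -/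
def shVehicle (S : Setting) (dF aF dB aB : ℝ) {N : ℕ} (v t : Fin N → ℝ) :
    (n : ℕ) → n < N → Option (ℝ → ℝ)
  | 0, h => shStep S dF aF dB aB (v ⟨0, h⟩) (t ⟨0, h⟩) none
  | n + 1, h =>
    (shVehicle S dF aF dB aB v t n (Nat.lt_of_succ_lt h)).bind fun q =>
      shStep S dF aF dB aB (v ⟨n + 1, h⟩) (t ⟨n + 1, h⟩) (some q)

open Classical in
/-- The shooting heuristic: the vector of all constructed trajectories, or `none` (the empty
output) if some vehicle fails. -/
def shootingHeuristic (S : Setting) (dF aF dB aB : ℝ) {N : ℕ} (v t : Fin N → ℝ) :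
    Option (Fin N → ℝ → ℝ) :=
  if h : ∀ n : Fin N, (shVehicle S dF aF dB aB v t n n.isLt).isSome then
    some fun n => (shVehicle S dF aF dB aB v t n n.isLt).get (h n)
  else none

end SignalTraj

end

noncomputable section

namespace SignalTraj

open Set Filter Topology

/-! The heuristic is greedy, and it works because each constructed trajectory is the greatest
element of the set of competitors of its vehicle. Raising a leader raises its shadow, so a follower
only gains room. By induction the heuristic therefore stays ahead of any full-speed feasible vector
and cannot fail while one exists (`exists_shVehicle_eq_some`); conversely its output is itself
feasible with full-speed exits (`mem_feasibleFullSpeed_of_shVehicle`).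

Maximality is checked piece by piece. A template dominates because it integrates the extreme speed
allowed at each instant. A merging parabola dominates because parabola minus trajectory is concave
and nonnegative at both ends (`Kin.le_quad_of_endpoints`). The remaining piece is the bound itself.
In the backward step, a competitor lies below the forward shooting, so its green exit is no earlier
than the next green time; leaving at speed `vMax`, it lies below the backward template
(`FwdSpec.le_bwdTemplate`).

Merging segments exist by a continuity argument: the point of leaving the template is moved until
the path first touches the bound (`exists_contact`), and first-order conditions at the contact give
tangency.

The condition on `L` is used twice: a vehicle has reached `vMax` by the time its forward template is
at `L`, so every constructed path cruises beyond `L`; and the backward template never goes below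
location `0`, so contact with the forward section occurs no later than its start, going backwards.
-/

/-! ### Kinematic comparison -/

/-- The consequences of kinematic feasibility used in comparison arguments. -/
structure Kin (S : Setting) (p : ℝ → ℝ) : Prop where
  diff : Differentiable ℝ p
  nonneg : ∀ t, 0 ≤ deriv p t
  le_vMax : ∀ t, deriv p t ≤ S.vMax
  lower : ∀ ⦃s t⦄, s ≤ t → S.aMin * (t - s) ≤ deriv p t - deriv p s
  upper : ∀ ⦃s t⦄, s ≤ t → deriv p t - deriv p s ≤ S.aMax * (t - s)

lemma hasDerivWithinAt_linear (c s x : ℝ) (I : Set ℝ) :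
    HasDerivWithinAt (fun t => c * (t - s)) c I x := by
  simpa using ((hasDerivAt_id x).sub_const s).const_mul c |>.hasDerivWithinAt (s := I)

/-- Absolute continuity makes the velocity continuous, and for a continuous function bounds on the
right derivative at every point bound the increments. The acceleration need not be integrated. -/
lemma kin_of_mem_kinematic {S : Setting} {p : ℝ → ℝ} (h : p ∈ kinematic S) : Kin S p := by
  obtain ⟨hp, hb⟩ := h
  have hcont : ∀ a b : ℝ, a ≤ b → ContinuousOn (deriv p) (Icc a b) := fun a b hab => by
    simpa [uIcc_of_le hab] using (hp.velocity_ac a b).continuousOn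
  have hd : ∀ x, HasDerivWithinAt (deriv p) (accel p x) (Ici x) x :=
    fun x => (hp.velocity_rightDiff x).hasDerivWithinAt
  refine ⟨hp.differentiable, fun t => (hb t).1.1, fun t => (hb t).1.2, ?_, ?_⟩
  · intro s t hst
    have := image_le_of_deriv_right_le_deriv_boundary (f := fun t => S.aMin * (t - s))
      (f' := fun _ => S.aMin) (B := fun t => deriv p t - deriv p s) (B' := accel p)
      (a := s) (b := t) (by fun_prop) (fun x _ => hasDerivWithinAt_linear _ _ _ _)
      (by simp) ((hcont s t hst).sub continuousOn_const) (fun x _ => (hd x).sub_const _)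
      (fun x _ => (hb x).2.1) (right_mem_Icc.2 hst)
    exact this
  · intro s t hst
    have := image_le_of_deriv_right_le_deriv_boundary (B := fun t => S.aMax * (t - s))
      (B' := fun _ => S.aMax) (f := fun t => deriv p t - deriv p s) (f' := accel p)
      (a := s) (b := t) ((hcont s t hst).sub continuousOn_const) (fun x _ => (hd x).sub_const _)
      (by simp) (by fun_prop) (fun x _ => hasDerivWithinAt_linear _ _ _ _)
      (fun x _ => (hb x).2.2) (right_mem_Icc.2 hst)
    exact this

lemma sub_le_sub_of_deriv_le {f g f' g' : ℝ → ℝ} {a b : ℝ} (hab : a ≤ b)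
    (hf : ∀ x ∈ Icc a b, HasDerivAt f (f' x) x) (hg : ∀ x ∈ Icc a b, HasDerivAt g (g' x) x)
    (h : ∀ x ∈ Icc a b, f' x ≤ g' x) : f b - f a ≤ g b - g a := by
  have := image_le_of_deriv_right_le_deriv_boundary (f := fun x => f x - f a)
    (B := fun x => g x - g a) (f' := f') (B' := g') (a := a) (b := b)
    (fun x hx => ((hf x hx).sub_const _).continuousAt.continuousWithinAt)
    (fun x hx => ((hf x (Ico_subset_Icc_self hx)).sub_const _).hasDerivWithinAt)
    (by simp)
    (fun x hx => ((hg x hx).sub_const _).continuousAt.continuousWithinAt)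
    (fun x hx => ((hg x (Ico_subset_Icc_self hx)).sub_const _).hasDerivWithinAt)
    (fun x hx => h x (Ico_subset_Icc_self hx)) (right_mem_Icc.2 hab)
  exact this

lemma hasDerivAt_quad (l v a t₀ t : ℝ) :
    HasDerivAt (quad l v a t₀) (v + a * (t - t₀)) t := by
  have h1 : HasDerivAt (fun t => t - t₀) 1 t := (hasDerivAt_id t).sub_const t₀
  have := (((h1.pow 2).const_mul (a / 2)).add (h1.const_mul v)).add_const l
  refine HasDerivAt.congr_deriv (f := quad l v a t₀) this ?_
  norm_num
  ring

@[simp] lemma quad_self (l v a t₀ : ℝ) : quad l v a t₀ t₀ = l := by simp [quad]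

namespace Kin

variable {S : Setting} {p : ℝ → ℝ}

lemma hasDerivAt (hp : Kin S p) (t : ℝ) : HasDerivAt p (deriv p t) t := (hp.diff t).hasDerivAt

lemma mono (hp : Kin S p) : Monotone p := monotone_of_deriv_nonneg hp.diff hp.nonneg

lemma continuous (hp : Kin S p) : Continuous p := hp.diff.continuous

lemma le_cruise (hp : Kin S p) {s t : ℝ} (hst : s ≤ t) : p t ≤ p s + S.vMax * (t - s) := by
  have := sub_le_sub_of_deriv_le hst (fun x _ => hp.hasDerivAt x)
    (fun x _ => hasDerivAt_quad 0 S.vMax 0 s x) (fun x _ => by simpa using hp.le_vMax x)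
  simp [quad] at this
  linarith

lemma quad_aMin_le (hp : Kin S p) {s t : ℝ} (hst : s ≤ t) :
    quad (p s) (deriv p s) S.aMin s t ≤ p t := by
  have := sub_le_sub_of_deriv_le hst (fun x _ => hasDerivAt_quad (p s) (deriv p s) S.aMin s x)
    (fun x _ => hp.hasDerivAt x) (fun x hx => by linarith [hp.lower hx.1])
  simp only [quad_self] at this
  linarith

lemma le_quad_aMax (hp : Kin S p) {s t : ℝ} (hst : s ≤ t) :
    p t ≤ quad (p s) (deriv p s) S.aMax s t := by
  have := sub_le_sub_of_deriv_le hst (fun x _ => hp.hasDerivAt x)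
    (fun x _ => hasDerivAt_quad (p s) (deriv p s) S.aMax s x)
    (fun x hx => by linarith [hp.upper hx.1])
  rw [quad_self] at this
  linarith

/-- A parabola of acceleration `aMin` dominates a trajectory between two points where it does. -/
lemma le_quad_of_endpoints (hp : Kin S p) {l w s₀ a b t : ℝ} (ha : p a ≤ quad l w S.aMin s₀ a)
    (hb : p b ≤ quad l w S.aMin s₀ b) (hat : a ≤ t) (htb : t ≤ b) :
    p t ≤ quad l w S.aMin s₀ t := by
  have hder : ∀ x, HasDerivAt (fun x => quad l w S.aMin s₀ x - p x)
      (w + S.aMin * (x - s₀) - deriv p x) x :=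
    fun x => (hasDerivAt_quad l w S.aMin s₀ x).sub (hp.hasDerivAt x)
  -- The speed of `p` changes at rate at least `aMin`, so parabola minus `p` is concave, hence at
  -- least its smaller end value on `[a, b]`.
  have hanti : Antitone (deriv fun x => quad l w S.aMin s₀ x - p x) := by
    intro x y hxy
    rw [(hder x).deriv, (hder y).deriv]
    linarith [hp.lower hxy]
  have hc := hanti.concaveOn_univ_of_deriv (fun x => (hder x).differentiableAt)
  have := hc.min_le_of_mem_Icc (mem_univ a) (mem_univ b) ⟨hat, htb⟩
  have h0 : 0 ≤ min (quad l w S.aMin s₀ a - p a) (quad l w S.aMin s₀ b - p b) :=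
    le_min (by linarith) (by linarith)
  exact sub_nonneg.1 (h0.trans this)

end Kin

/-! ### Gluing motions -/

/-- `p` has velocity `w`, and `w` is continuous with right derivative `a`, which is continuous
off a finite set. -/
structure Motion (p w a : ℝ → ℝ) : Prop where
  hasDerivAt : ∀ t, HasDerivAt p (w t) t
  cont : Continuous w
  right : ∀ t, HasDerivWithinAt w (a t) (Ici t) t
  pieces : ∃ D : Set ℝ, D.Finite ∧ ∀ t, t ∉ D → ContinuousAt a t

/-- Bounds on velocity and acceleration. -/
def Bounded (S : Setting) (w a : ℝ → ℝ) : Prop :=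
  ∀ t, (0 ≤ w t ∧ w t ≤ S.vMax) ∧ (S.aMin ≤ a t ∧ a t ≤ S.aMax)

/-- `f` up to time `c`, then `g`. -/
def glue (c : ℝ) (f g : ℝ → ℝ) (t : ℝ) : ℝ := if t ≤ c then f t else g t

lemma glue_left {c t : ℝ} (f g : ℝ → ℝ) (h : t ≤ c) : glue c f g t = f t := if_pos h

lemma glue_right {c t : ℝ} {f g : ℝ → ℝ} (h : c ≤ t) (hc : f c = g c) : glue c f g t = g t := by
  rcases h.eq_or_lt with rfl | h
  · simp [glue, hc]
  · simp [glue, h.not_ge]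

lemma hasDerivAt_glue {f g w z : ℝ → ℝ} {c : ℝ} (hf : ∀ t, t ≤ c → HasDerivAt f (w t) t)
    (hg : ∀ t, c ≤ t → HasDerivAt g (z t) t) (h : f c = g c) (h' : w c = z c) (t : ℝ) :
    HasDerivAt (glue c f g) (glue c w z t) t := by
  rcases lt_trichotomy t c with ht | rfl | ht
  · rw [glue_left _ _ ht.le]
    refine (hf t ht.le).congr_of_eventuallyEq ?_
    filter_upwards [Iio_mem_nhds ht] with x hx using glue_left _ _ (le_of_lt hx)
  · rw [glue_left _ _ le_rfl]
    have h1 : HasDerivWithinAt (glue t f g) (w t) (Iic t) t :=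
      (hf t le_rfl).hasDerivWithinAt.congr (fun x hx => glue_left _ _ hx) (glue_left _ _ le_rfl)
    have h2 : HasDerivWithinAt (glue t f g) (w t) (Ici t) t := by
      rw [h']
      exact (hg t le_rfl).hasDerivWithinAt.congr (fun x hx => glue_right hx h)
        (glue_right le_rfl h)
    have := h1.union h2
    rwa [Iic_union_Ici, hasDerivWithinAt_univ] at this
  · rw [glue_right ht.le h']
    refine (hg t ht.le).congr_of_eventuallyEq ?_
    filter_upwards [Ioi_mem_nhds ht] with x hx using glue_right (le_of_lt hx) h

/-- The acceleration is split with `<` rather than `≤`, since the right derivative at the junction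
is that of the second piece. The acceleration may jump there, so `c` joins the exceptional set. -/
lemma Motion.glue {p w a q x b : ℝ → ℝ} {c : ℝ} (hp : Motion p w a) (hq : Motion q x b)
    (h : p c = q c) (h' : w c = x c) :
    Motion (SignalTraj.glue c p q) (SignalTraj.glue c w x) (fun t => if t < c then a t else b t) := by
  refine ⟨hasDerivAt_glue (fun t _ => hp.hasDerivAt t) (fun t _ => hq.hasDerivAt t) h h', ?_, ?_,
    ?_⟩
  · exact Continuous.if_le hp.cont hq.cont continuous_id continuous_const
      (fun t ht => by rw [ht]; exact h')
  · intro t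
    by_cases ht : t < c
    · simp only [ht, if_true]
      refine (hp.right t).congr_of_eventuallyEq ?_ (glue_left _ _ ht.le)
      filter_upwards [mem_nhdsWithin_of_mem_nhds (Iio_mem_nhds ht)] with y hy
        using glue_left _ _ (le_of_lt hy)
    · simp only [ht, if_false]
      exact (hq.right t).congr (fun y hy => glue_right ((not_lt.1 ht).trans hy) h')
        (glue_right (not_lt.1 ht) h')
  · obtain ⟨D, hD, hDa⟩ := hp.pieces
    obtain ⟨E, hE, hEb⟩ := hq.pieces
    refine ⟨insert c (D ∪ E), (hD.union hE).insert c, fun t ht => ?_⟩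
    simp only [mem_insert_iff, mem_union, not_or] at ht
    rcases lt_or_gt_of_ne ht.1 with h1 | h1
    · refine (hDa t ht.2.1).congr ?_
      filter_upwards [Iio_mem_nhds h1] with y hy
      simp only [mem_Iio] at hy; simp [hy]
    · refine (hEb t ht.2.2).congr ?_
      filter_upwards [Ioi_mem_nhds h1] with y hy
      simp only [mem_Ioi] at hy; simp [hy.not_gt]

lemma motion_quad (l v a t₀ : ℝ) :
    Motion (quad l v a t₀) (fun t => v + a * (t - t₀)) (fun _ => a) := by
  refine ⟨hasDerivAt_quad l v a t₀, by fun_prop, fun t => ?_, ∅, finite_empty, fun t _ =>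
    continuousAt_const⟩
  exact (hasDerivWithinAt_linear a t₀ t _).const_add v

lemma Motion.shadow {p w a : ℝ → ℝ} (hp : Motion p w a) (S : Setting) :
    Motion (SignalTraj.shadow S p) (fun t => w (t - S.τ)) (fun t => a (t - S.τ)) := by
  refine ⟨fun t => ?_, hp.cont.comp (by fun_prop), fun t => ?_, ?_⟩
  · exact ((hp.hasDerivAt (t - S.τ)).comp_sub_const t S.τ).sub_const S.s
  · have h1 : HasDerivWithinAt (fun t => t - S.τ) 1 (Ici t) t :=
      ((hasDerivAt_id t).sub_const S.τ).hasDerivWithinAt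
    have := (hp.right (t - S.τ)).comp t h1 (fun y hy => by
      simp only [mem_Ici] at hy ⊢; linarith)
    simpa [Function.comp_def] using this
  · obtain ⟨D, hD, h⟩ := hp.pieces
    refine ⟨(fun t => t - S.τ) ⁻¹' D, hD.preimage (fun x _ y _ h => by simpa using h),
      fun t ht => ?_⟩
    exact ContinuousAt.comp (f := fun t => t - S.τ) (g := a) (h _ ht) (by fun_prop)

/-! ### Bounded motions are kinematically feasible trajectories. -/

lemma Motion.deriv_eq {p w a : ℝ → ℝ} (hp : Motion p w a) : deriv p = w :=
  funext fun t => (hp.hasDerivAt t).deriv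

lemma Motion.accel_eq {p w a : ℝ → ℝ} (hp : Motion p w a) : accel p = a := by
  funext t
  rw [accel, hp.deriv_eq]
  exact (hp.right t).derivWithin (uniqueDiffWithinAt_Ici t)

/-- Lebesgue's criterion: the discontinuities form a finite, hence null, set. -/
lemma locallyRiemannIntegrable_of_piecewise {f : ℝ → ℝ} {C : ℝ} (hC : ∀ t, |f t| ≤ C)
    {D : Set ℝ} (hD : D.Finite) (h : ∀ t, t ∉ D → ContinuousAt f t) :
    LocallyRiemannIntegrable f := by
  intro I
  have hb : ∃ C : ℝ, ∀ x ∈ BoxIntegral.Box.Icc I, ‖f (x 0)‖ ≤ C := ⟨C, fun x _ => hC (x 0)⟩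
  refine BoxIntegral.integrable_of_bounded_and_ae_continuous (E := ℝ)
    (f := fun x : Fin 1 → ℝ => f (x 0)) BoxIntegral.IntegrationParams.Riemann hb
    MeasureTheory.volume ?_
  have hfin : ((fun x : Fin 1 → ℝ => x 0) ⁻¹' D).Finite := by
    refine hD.preimage (fun x _ y _ hxy => ?_)
    funext i
    rw [Subsingleton.elim i 0]
    exact hxy
  have h0 : MeasureTheory.volume ((fun x : Fin 1 → ℝ => x 0) ⁻¹' D) = 0 :=
    hfin.measure_zero _
  rw [MeasureTheory.ae_iff]
  refine MeasureTheory.measure_mono_null (fun x hx => ?_) h0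
  by_contra hxD
  exact hx (ContinuousAt.comp (f := fun x : Fin 1 → ℝ => x 0) (g := f) (h _ hxD)
    (continuous_apply 0).continuousAt)

lemma Motion.mem_kinematic {S : Setting} {p w a : ℝ → ℝ} (hp : Motion p w a)
    (hb : Bounded S w a) : p ∈ kinematic S := by
  set C : ℝ := max |S.aMin| |S.aMax| with hCdef
  have hC : ∀ t, |a t| ≤ C := fun t => abs_le_max_abs_abs (hb t).2.1 (hb t).2.2
  have hC0 : 0 ≤ C := (abs_nonneg _).trans (hC 0)
  have hlip : LipschitzWith ⟨C, hC0⟩ w := by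
    refine LipschitzWith.of_le_add_mul _ (fun x y => ?_)
    have key : ∀ x y, x ≤ y → |w y - w x| ≤ C * (y - x) := fun x y hxy => by
      have := norm_image_sub_le_of_norm_deriv_right_le_segment (f := w) (f' := a) (C := C)
        (a := x) (b := y) hp.cont.continuousOn (fun z _ => hp.right z) (fun z _ => hC z) y
        (right_mem_Icc.2 hxy)
      simpa using this
    rw [Real.dist_eq]
    change w x ≤ w y + C * |x - y|
    rcases le_total x y with h | h
    · have := key x y h
      rw [abs_sub_comm x y, abs_of_nonneg (sub_nonneg.2 h)]
      linarith [neg_abs_le (w y - w x)]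
    · have := key y x h
      rw [abs_of_nonneg (sub_nonneg.2 h)]
      linarith [le_abs_self (w x - w y)]
  obtain ⟨D, hD, hDa⟩ := hp.pieces
  refine ⟨⟨fun t => (hp.hasDerivAt t).differentiableAt, fun x y => ?_, fun t => ?_, ?_⟩, ?_⟩
  · rw [hp.deriv_eq]
    exact hlip.lipschitzOnWith.absolutelyContinuousOnInterval
  · rw [hp.deriv_eq]
    exact (hp.right t).differentiableWithinAt
  · rw [hp.accel_eq]
    exact locallyRiemannIntegrable_of_piecewise hC hD hDa
  · rw [hp.deriv_eq, hp.accel_eq]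
    exact hb

lemma Motion.kin {S : Setting} {p w a : ℝ → ℝ} (hp : Motion p w a) (hb : Bounded S w a) :
    Kin S p :=
  kin_of_mem_kinematic (hp.mem_kinematic hb)

/-! ### Contact of a one-parameter family of paths with a bound -/

/-- Serves contacts at the left end of the time interval, where a one-sided comparison yields only
an inequality of speeds. -/
lemma deriv_le_deriv_of_touch {f g : ℝ → ℝ} {f' g' a b : ℝ} (hab : a < b)
    (hf : HasDerivAt f f' a) (hg : HasDerivAt g g' a) (h0 : f a = g a)
    (h : ∀ t, a ≤ t → t ≤ b → f t ≤ g t) : f' ≤ g' := by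
  have h1 : HasDerivWithinAt (fun t => g t - f t) (g' - f') (Ioi a) a :=
    (hg.sub hf).hasDerivWithinAt
  rw [hasDerivWithinAt_iff_tendsto_slope' self_notMem_Ioi] at h1
  have h2 : 0 ≤ g' - f' := by
    refine ge_of_tendsto h1 ?_
    filter_upwards [Ioo_mem_nhdsGT hab] with t ht
    rw [slope_def_field]
    have := h t ht.1.le ht.2.le
    exact div_nonneg (by linarith) (by linarith [ht.1])
  linarith

lemma deriv_eq_deriv_of_touch {f g : ℝ → ℝ} {f' g' a b c : ℝ} (hab : a < b) (hbc : b < c)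
    (hf : HasDerivAt f f' b) (hg : HasDerivAt g g' b) (h0 : f b = g b)
    (h : ∀ t, a ≤ t → t ≤ c → f t ≤ g t) : f' = g' := by
  have hmin : IsLocalMin (fun t => g t - f t) b := by
    filter_upwards [Icc_mem_nhds hab hbc] with t ht
    have := h t ht.1 ht.2
    linarith
  linarith [hmin.hasDerivAt_eq_zero (hg.sub hf)]

/-- The last parameter up to which a continuous family stays nonpositive on a compact set:
there the family touches zero, and it becomes positive nearby for slightly larger parameters. -/
lemma exists_contact {H : ℝ × ℝ → ℝ} (hH : Continuous H) {α β : ℝ} {K : Set ℝ} (hK : IsCompact K)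
    (hαβ : α ≤ β) (hα : ∀ t ∈ K, H (α, t) ≤ 0) {r : ℝ} (hr : r ∈ K) (hβ : 0 < H (β, r)) :
    ∃ m ∈ Ico α β, ∃ c ∈ K, (∀ t ∈ K, H (m, t) ≤ 0) ∧ H (m, c) = 0 ∧
      ∀ ε > 0, ∃ m' ∈ Ioo m (m + ε), ∃ t ∈ K, |t - c| < ε ∧ 0 < H (m', t) := by
  set A : Set ℝ := {m | m ∈ Icc α β ∧ ∀ t ∈ K, H (m, t) ≤ 0} with hA
  have hAc : IsClosed A := by
    have : A = Icc α β ∩ ⋂ t ∈ K, {m | H (m, t) ≤ 0} := by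
      ext m; simp [hA]
    rw [this]
    refine isClosed_Icc.inter (isClosed_biInter fun t _ => ?_)
    exact isClosed_le (hH.comp (by fun_prop)) continuous_const
  have hAne : A.Nonempty := ⟨α, ⟨le_rfl, hαβ⟩, hα⟩
  have hAb : BddAbove A := ⟨β, fun m hm => hm.1.2⟩
  have hm : sSup A ∈ A := hAc.csSup_mem hAne hAb
  set m := sSup A with hmdef
  have hmβ : m < β := by
    rcases hm.1.2.eq_or_lt with h | h
    · have := hm.2 r hr
      rw [h] at this
      exact absurd this hβ.not_ge
    · exact h
  -- Parameters above `m` tending to `m`: each is violated at some time `y k` of `K`, and a limit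
  -- point of these times is the contact `c`.
  set x : ℕ → ℝ := fun k => m + (β - m) / (k + 1) with hx
  have hxpos : ∀ k : ℕ, 0 < (β - m) / ((k : ℝ) + 1) := fun k =>
    div_pos (by linarith) (by positivity)
  have hxβ : ∀ k, x k ≤ β := fun k => by
    have : (β - m) / ((k : ℝ) + 1) ≤ β - m :=
      div_le_self (by linarith) (by linarith [(Nat.cast_nonneg k : (0 : ℝ) ≤ k)])
    simp only [hx]; linarith
  have hfail : ∀ k, ∃ t ∈ K, 0 < H (x k, t) := by
    intro k
    by_contra hcon
    push Not at hcon
    have : x k ≤ m := le_csSup hAb ⟨⟨hm.1.1.trans (by simp only [hx]; linarith [hxpos k]), hxβ k⟩, hcon⟩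
    simp only [hx] at this
    linarith [hxpos k]
  choose y hyK hy using hfail
  obtain ⟨c, hcK, φ, hφ, hlim⟩ := hK.tendsto_subseq hyK
  have hxlim : Tendsto x atTop (𝓝 m) := by
    have h1 : Tendsto (fun k : ℕ => (β - m) * (1 / ((k : ℝ) + 1))) atTop (𝓝 ((β - m) * 0)) :=
      tendsto_one_div_add_atTop_nhds_zero_nat.const_mul _
    have h2 := h1.const_add m
    simp only [mul_zero, add_zero] at h2
    refine h2.congr (fun k => ?_)
    simp only [hx]; ring
  have hxφ := hxlim.comp hφ.tendsto_atTop
  refine ⟨m, ⟨hm.1.1, hmβ⟩, c, hcK, hm.2, le_antisymm (hm.2 c hcK) ?_, fun ε hε => ?_⟩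
  · have h1 : Tendsto (fun k => H (x (φ k), y (φ k))) atTop (𝓝 (H (m, c))) :=
      (hH.tendsto (m, c)).comp (hxφ.prodMk_nhds hlim)
    exact ge_of_tendsto' h1 fun k => (hy _).le
  · have e1 : ∀ᶠ k in atTop, x (φ k) < m + ε := hxφ.eventually_lt_const (by linarith)
    have e2 : ∀ᶠ k in atTop, dist (y (φ k)) c < ε := hlim.eventually (Metric.ball_mem_nhds c hε)
    obtain ⟨k, h1, h2⟩ := (e1.and e2).exists
    exact ⟨x (φ k), ⟨by simp only [hx]; linarith [hxpos (φ k)], h1⟩, y (φ k), hyK _, h2, hy _⟩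

/-! ### The forward template -/

/-- The standing assumptions on the physical data. -/
structure Setting.Valid (S : Setting) : Prop where
  G_pos : 0 < S.G
  R_nonneg : 0 ≤ S.R
  vMax_pos : 0 < S.vMax
  aMin_neg : S.aMin < 0
  aMax_pos : 0 < S.aMax
  s_pos : 0 < S.s
  τ_nonneg : 0 ≤ S.τ
  L_ge : S.vMax ^ 2 / (2 * S.aMax) ≤ S.L

lemma Setting.Valid.sq_le {S : Setting} (hS : S.Valid) : S.vMax ^ 2 ≤ 2 * S.aMax * S.L := by
  have := (div_le_iff₀ (by linarith [hS.aMax_pos])).1 hS.L_ge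
  linarith

lemma Setting.Valid.L_pos {S : Setting} (hS : S.Valid) : 0 < S.L :=
  lt_of_lt_of_le (div_pos (pow_pos hS.vMax_pos 2) (by linarith [hS.aMax_pos])) hS.L_ge

/-- A feasible piecewise smooth motion. -/
def Nice (S : Setting) (f : ℝ → ℝ) : Prop := ∃ w a, Motion f w a ∧ Bounded S w a

lemma Nice.kin {S : Setting} {f : ℝ → ℝ} (h : Nice S f) : Kin S f := by
  obtain ⟨w, a, hm, hb⟩ := h
  exact hm.kin hb

lemma Nice.shadow {S : Setting} {f : ℝ → ℝ} (h : Nice S f) : Nice S (shadow S f) := by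
  obtain ⟨w, a, hm, hb⟩ := h
  exact ⟨_, _, hm.shadow S, fun t => hb _⟩

lemma Kin.shadow {S : Setting} {f : ℝ → ℝ} (h : Kin S f) (t : ℝ) :
    HasDerivAt (SignalTraj.shadow S f) (deriv f (t - S.τ)) t :=
  ((h.hasDerivAt (t - S.τ)).comp_sub_const t S.τ).sub_const S.s

section Template

variable {S : Setting} {l v t₀ : ℝ}

lemma fwdTemplate_self : fwdTemplate S S.aMax l v t₀ t₀ = l := by simp [fwdTemplate]

lemma fwdSpeed_self (hv : v ≤ S.vMax) : fwdSpeed S S.aMax v t₀ t₀ = v := by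
  simp [fwdSpeed, hv]

lemma fwdSpeed_le {t : ℝ} : fwdSpeed S S.aMax v t₀ t ≤ S.vMax := min_le_left _ _

lemma fwdSpeed_nonneg (hS : S.Valid) (hv0 : 0 ≤ v) {t : ℝ} (ht : t₀ ≤ t) :
    0 ≤ fwdSpeed S S.aMax v t₀ t :=
  le_min hS.vMax_pos.le (add_nonneg hv0 (mul_nonneg hS.aMax_pos.le (sub_nonneg.2 ht)))

lemma nice_fwdTemplate (hS : S.Valid) (hv0 : 0 ≤ v) (hv : v ≤ S.vMax) :
    Nice S (fwdTemplate S S.aMax l v t₀) ∧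
      ∀ t, t₀ ≤ t → deriv (fwdTemplate S S.aMax l v t₀) t = fwdSpeed S S.aMax v t₀ t := by
  have ha := hS.aMax_pos
  have ha' := hS.aMin_neg
  set t₁ := t₀ + (S.vMax - v) / S.aMax with ht₁
  have h01 : t₀ ≤ t₁ := by
    have : 0 ≤ (S.vMax - v) / S.aMax := div_nonneg (by linarith) ha.le
    linarith
  have hspeed : v + S.aMax * (t₁ - t₀) = S.vMax := by
    rw [ht₁]; field_simp; ring
  set X := l + (S.vMax ^ 2 - v ^ 2) / (2 * S.aMax) with hX
  have hpos : quad l v S.aMax t₀ t₁ = X := by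
    rw [quad, ht₁, hX]; field_simp; ring
  have hm1 : Motion (glue t₁ (quad l v S.aMax t₀) (quad X S.vMax 0 t₁)) _ _ :=
    (motion_quad l v S.aMax t₀).glue (motion_quad X S.vMax 0 t₁) (by rw [hpos, quad_self])
      (by simp [hspeed])
  have hm0 := (motion_quad l v 0 t₀).glue hm1 (by rw [glue_left _ _ h01, quad_self, quad_self])
    (by rw [glue_left _ _ h01]; simp)
  have hm : Motion (fwdTemplate S S.aMax l v t₀) _ _ := hm0
  have hle : ∀ t, t ≤ t₁ → v + S.aMax * (t - t₀) ≤ S.vMax := fun t ht => by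
    rw [← hspeed]; gcongr
  have hge : ∀ t, t₁ ≤ t → S.vMax ≤ v + S.aMax * (t - t₀) := fun t ht => by
    rw [← hspeed]; gcongr
  refine ⟨⟨_, _, hm, fun t => ?_⟩, fun t ht => ?_⟩
  · have hV := hS.vMax_pos
    refine ⟨?_, ?_⟩
    · rcases le_total t t₀ with h | h
      · rw [glue_left _ _ h]; simp [hv0, hv]
      · rw [glue_right h (by rw [glue_left _ _ h01]; simp)]
        rcases le_total t t₁ with h' | h'
        · rw [glue_left _ _ h']
          exact ⟨add_nonneg hv0 (mul_nonneg ha.le (sub_nonneg.2 h)), hle t h'⟩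
        · rw [glue_right h' (by simp [hspeed])]
          simp [hV.le]
    · split_ifs <;> constructor <;> linarith
  · rw [hm.deriv_eq, glue_right ht (by rw [glue_left _ _ h01]; simp), fwdSpeed]
    rcases le_total t t₁ with h' | h'
    · rw [glue_left _ _ h', min_eq_right (hle t h')]
    · rw [glue_right h' (by simp [hspeed]), min_eq_left (hge t h')]
      simp

lemma Kin.le_fwdTemplate (hS : S.Valid) (hv0 : 0 ≤ v) (hv : v ≤ S.vMax) {p : ℝ → ℝ}
    (hp : Kin S p) (hl : p t₀ ≤ l) (hd : deriv p t₀ ≤ v) {t : ℝ} (ht : t₀ ≤ t) :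
    p t ≤ fwdTemplate S S.aMax l v t₀ t := by
  obtain ⟨hn, hT⟩ := nice_fwdTemplate (l := l) (t₀ := t₀) hS hv0 hv
  have := sub_le_sub_of_deriv_le ht (fun x _ => hp.hasDerivAt x) (fun x _ => hn.kin.hasDerivAt x)
    (fun x hx => by
      rw [hT x hx.1]
      exact le_min (hp.le_vMax x) (by linarith [hp.upper hx.1]))
  rw [fwdTemplate_self] at this
  linarith

lemma exists_le_fwdTemplate (hS : S.Valid) (hv : v ≤ S.vMax) (x : ℝ) :
    ∃ t, x ≤ fwdTemplate S S.aMax l v t₀ t := by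
  have hV := hS.vMax_pos
  set t₁ := t₀ + (S.vMax - v) / S.aMax with ht₁
  set X := l + (S.vMax ^ 2 - v ^ 2) / (2 * S.aMax) with hX
  have h01 : t₀ ≤ t₁ := by
    have : 0 ≤ (S.vMax - v) / S.aMax := div_nonneg (by linarith) hS.aMax_pos.le
    linarith
  have hpos : 0 < (|x - X| + 1) / S.vMax := by positivity
  refine ⟨t₁ + (|x - X| + 1) / S.vMax, ?_⟩
  rw [fwdTemplate, if_neg (by linarith), if_neg (by linarith), quad]
  simp only [← ht₁, ← hX]
  have : S.vMax * (t₁ + (|x - X| + 1) / S.vMax - t₁) = |x - X| + 1 := by field_simp; ring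
  rw [this]
  linarith [le_abs_self (x - X)]

/-- Accelerating at `aMax` from `v` to a speed `w < vMax` takes the distance `(w² - v²) / (2 aMax)`,
which is less than `L` by `L_ge`. -/
lemma fwdSpeed_eq_of_L_le (hS : S.Valid) (hv0 : 0 ≤ v) (hv : v ≤ S.vMax) {t : ℝ} (ht : t₀ ≤ t)
    (h : S.L ≤ fwdTemplate S S.aMax 0 v t₀ t) : fwdSpeed S S.aMax v t₀ t = S.vMax := by
  obtain ⟨hn, hT⟩ := nice_fwdTemplate (l := 0) (t₀ := t₀) hS hv0 hv
  refine min_eq_left ?_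
  by_contra hcon
  push Not at hcon
  have h1 := hn.kin.le_quad_aMax ht
  rw [hT t₀ le_rfl, fwdSpeed_self hv, fwdTemplate_self, quad] at h1
  have h2 := hS.sq_le
  have ha := hS.aMax_pos
  have h3 : 0 ≤ v + S.aMax * (t - t₀) := add_nonneg hv0 (mul_nonneg ha.le (sub_nonneg.2 ht))
  have h4 : (v + S.aMax * (t - t₀)) ^ 2 < S.vMax ^ 2 := pow_lt_pow_left₀ hcon h3 two_ne_zero
  have h5 : 2 * S.aMax * S.L ≤ 2 * S.aMax * (S.aMax / 2 * (t - t₀) ^ 2 + v * (t - t₀) + 0) :=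
    mul_le_mul_of_nonneg_left (h.trans h1) (by linarith)
  nlinarith [sq_nonneg v]

/-! ### Existence of the forward merging segment -/

/-- The time `m` of leaving the template is the parameter: `m = t₀` is admissible by `h0`, while `m
= r` is not, because the template is above `u` at `r`. At the last admissible `m` the path touches
`u`. -/
lemma exists_isFwdMerge (hS : S.Valid) (hv0 : 0 ≤ v) (hv : v ≤ S.vMax) {u : ℝ → ℝ}
    (hu : Kin S u) (h0 : ∀ t, t₀ ≤ t → quad l v S.aMin t₀ t ≤ u t) {r : ℝ} (hr : t₀ ≤ r)
    (hcross : u r < fwdTemplate S S.aMax l v t₀ r) :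
    ∃ m : ℝ × ℝ, IsFwdMerge S S.aMin S.aMax l v t₀ u m.1 m.2 := by
  obtain ⟨hn, hTd⟩ := nice_fwdTemplate (l := l) (t₀ := t₀) hS hv0 hv
  have hV0 : ∀ t, t₀ ≤ t → 0 ≤ fwdSpeed S S.aMax v t₀ t := fun t ht => fwdSpeed_nonneg hS hv0 ht
  have hVle : ∀ t, fwdSpeed S S.aMax v t₀ t ≤ S.vMax := fun t => fwdSpeed_le
  have hVs := fwdSpeed_self (t₀ := t₀) hv
  have hTs : fwdTemplate S S.aMax l v t₀ t₀ = l := fwdTemplate_self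
  have hVc : Continuous (fwdSpeed S S.aMax v t₀) := by unfold fwdSpeed; fun_prop
  have hdef : ∀ tm t, fwdMergeSeg S S.aMin S.aMax l v t₀ tm t = quad
    (fwdTemplate S S.aMax l v t₀ tm) (fwdSpeed S S.aMax v t₀ tm) S.aMin tm t := fun _ _ => rfl
  simp only [IsFwdMerge, hdef]
  clear hdef
  set T := fwdTemplate S S.aMax l v t₀ with hT
  set V := fwdSpeed S S.aMax v t₀ with hV
  have hk := hn.kin
  have ha := hS.aMin_neg
  have ha' := hS.aMax_pos
  let seg : ℝ → ℝ → ℝ := fun m => quad (T m) (V m) S.aMin m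
  have hsegT : ∀ m t, t₀ ≤ m → m ≤ t → seg m t ≤ T t := fun m t hm ht => by
    have := hk.quad_aMin_le ht
    rwa [hTd m hm] at this
  let H : ℝ × ℝ → ℝ := fun x => glue x.1 T (seg x.1) x.2 - u x.2
  have hH : Continuous H := by
    refine Continuous.sub ?_ (hu.continuous.comp continuous_snd)
    have hTc := hk.continuous
    refine Continuous.if_le (hTc.comp continuous_snd) ?_ continuous_snd continuous_fst ?_
    · simp only [seg, quad]; fun_prop
    · rintro ⟨x, y⟩ hxy
      simp only at hxy
      simp [seg, hxy]
  -- Every parabola leaving by time `r` has reached its apex by time `B`; afterwards it falls while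
  -- `u` does not. Comparison on the compact interval `[t₀, B]` thus suffices.
  set B := r + S.vMax / (-S.aMin) with hB
  have hBr : r ≤ B := by
    have : 0 ≤ S.vMax / (-S.aMin) := div_nonneg hS.vMax_pos.le (by linarith)
    linarith
  have hstart : ∀ t ∈ Icc t₀ B, H (t₀, t) ≤ 0 := fun t ht => by
    have := h0 t ht.1
    simp only [H]
    rw [glue_right ht.1 (by simp [seg])]
    simp only [seg, hTs, hVs]
    linarith
  obtain ⟨m, ⟨hm0, hmr⟩, c, ⟨hc0, hcB⟩, hle, hmc, hnear⟩ := exists_contact hH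
    (isCompact_Icc (a := t₀) (b := B)) hr hstart (r := r) ⟨hr, hBr⟩
    (by simp only [H]; rw [glue_left _ _ le_rfl]; linarith)
  have hsm : T m = seg m m := by simp [seg]
  -- Before `m` the path does not change when the parameter increases, so violations for larger
  -- parameters cannot accumulate there.
  have hmc' : m ≤ c := by
    by_contra hcon
    push Not at hcon
    obtain ⟨m', hm', t, ht, htc, hpos⟩ := hnear (m - c) (by linarith)
    have htm : t < m := by linarith [le_abs_self (t - c)]
    have h1 := hle t ht
    simp only [H] at h1 hpos
    rw [glue_left _ _ htm.le] at h1
    rw [glue_left _ _ (htm.trans hm'.1).le] at hpos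
    linarith
  have hbelow : ∀ t, t₀ ≤ t → glue m T (seg m) t ≤ u t := by
    intro t ht
    rcases le_total t B with h | h
    · have := hle t ⟨ht, h⟩
      simp only [H] at this
      linarith
    · set q := m + V m / (-S.aMin) with hq
      have hneg : (0 : ℝ) < -S.aMin := by linarith
      have hq1 : 0 ≤ V m / (-S.aMin) := div_nonneg (hV0 m hm0) hneg.le
      have hq2 : V m / (-S.aMin) ≤ S.vMax / (-S.aMin) :=
        div_le_div_of_nonneg_right (hVle m) hneg.le
      have hqB : q ≤ B := by linarith
      have hmq : m ≤ q := by linarith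
      have h1 := hle q ⟨by linarith, hqB⟩
      simp only [H] at h1
      rw [glue_right hmq hsm] at h1
      rw [glue_right (by linarith) hsm]
      have h2 : seg m t ≤ seg m q := by
        simp only [seg, quad]
        have hVq : V m = -S.aMin * (q - m) := by
          rw [hq, add_sub_cancel_left, mul_div_cancel₀ _ hneg.ne']
        rw [hVq]
        nlinarith [mul_nonneg hneg.le (sq_nonneg (t - q))]
      exact h2.trans (by linarith [hu.mono (hqB.trans h)])
  have hcon : glue m T (seg m) c = u c := by simp only [H] at hmc; linarith
  have hTder : HasDerivAt (glue m T (seg m)) (V m + S.aMin * (c - m)) c := by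
    have := hasDerivAt_glue (f := T) (g := seg m) (c := m) (w := deriv T)
      (z := fun t => V m + S.aMin * (t - m)) (fun t _ => hk.hasDerivAt t)
      (fun t _ => hasDerivAt_quad _ _ _ _ t) hsm (by simp [hTd m hm0]) c
    rwa [glue_right hmc' (by simp [hTd m hm0])] at this
  have hspeed : V m + S.aMin * (c - m) = deriv u c := by
    rcases hc0.eq_or_lt with h | h
    · subst h
      obtain rfl : m = t₀ := le_antisymm hmc' hm0
      refine le_antisymm (deriv_le_deriv_of_touch (lt_add_one m) hTder (hu.hasDerivAt m) hcon
        fun t ht _ => hbelow t ht) ?_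
      -- If `u` left `l` faster than `v`, it could not be overtaken by the template during a time `2
      -- (u' - v) / (aMax - aMin)`; yet slightly larger parameters give violations within half that
      -- time.
      by_contra hlt
      push Not at hlt
      simp only [sub_self, mul_zero, add_zero, hVs] at hlt
      have hul : u m = l := by rw [← hcon, glue_left _ _ le_rfl, hTs]
      have hden : 0 < S.aMax - S.aMin := by linarith
      obtain ⟨m', hm', t, ht, htc, hpos⟩ := hnear ((deriv u m - v) / (S.aMax - S.aMin))
        (div_pos (by linarith) hden)
      have hmt : m ≤ t := ht.1
      have h1 : glue m' T (seg m') t ≤ T t := by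
        rcases le_total t m' with h | h
        · rw [glue_left _ _ h]
        · rw [glue_right h (by simp [seg])]
          exact hsegT m' t hm'.1.le h
      have h2 := hk.le_quad_aMax hmt
      rw [hTs, hTd m le_rfl, hVs] at h2
      have h3 := hu.quad_aMin_le hmt
      rw [hul] at h3
      rw [abs_of_nonneg (by linarith), lt_div_iff₀ hden] at htc
      simp only [H] at hpos
      simp only [quad] at h2 h3
      nlinarith
    · exact deriv_eq_deriv_of_touch h (lt_add_one c) hTder (hu.hasDerivAt c) hcon
        fun t ht _ => hbelow t ht
  refine ⟨(m, c), hm0, hmc', fun t ht htm => ?_, fun t ht => ?_, ?_, hspeed⟩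
  · have := hbelow t ht
    rwa [glue_left _ _ htm] at this
  · have := hbelow t (hm0.trans ht)
    rwa [glue_right ht hsm] at this
  · rw [← hcon, glue_right hmc' hsm]

end Template

/-! ### Forward shooting -/

/-- The properties of the forward shooting trajectory `f` from `(l, v, t₀)` below `ub`: it is
feasible, and it is the greatest feasible trajectory below the bound. -/
structure FwdSpec (S : Setting) (l v t₀ : ℝ) (ub : Option (ℝ → ℝ)) (f : ℝ → ℝ) : Prop where
  nice : Nice S f
  start : f t₀ = l
  start_speed : deriv f t₀ = v
  below : ∀ u ∈ ub, ∀ t, t₀ ≤ t → f t ≤ u t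
  greatest : ∀ p, Kin S p → p t₀ ≤ l → deriv p t₀ ≤ v → (∀ u ∈ ub, ∀ t, t₀ ≤ t → p t ≤ u t) →
    ∀ t, t₀ ≤ t → p t ≤ f t
  -- The template condition stays a hypothesis because it has two sources: `L_ge` for a start at
  -- location `0`, and the initial speed `vMax` for the auxiliary shooting from `L`.
  cruise : (∀ t, t₀ ≤ t → S.L ≤ fwdTemplate S S.aMax l v t₀ t →
      fwdSpeed S S.aMax v t₀ t = S.vMax) →
    (∀ u ∈ ub, ∀ t, S.L ≤ u t → deriv u t = S.vMax) →
    ∀ t, t₀ ≤ t → S.L ≤ f t → deriv f t = S.vMax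
  reach : (∀ u ∈ ub, ∃ t, S.L ≤ u t) → ∃ t, S.L ≤ f t

section

variable {S : Setting} {l v t₀ : ℝ}

lemma fwdSpec_template (hS : S.Valid) (hv0 : 0 ≤ v) (hv : v ≤ S.vMax) {ub : Option (ℝ → ℝ)}
    (h : ∀ u ∈ ub, ∀ t, t₀ ≤ t → fwdTemplate S S.aMax l v t₀ t ≤ u t) :
    FwdSpec S l v t₀ ub (fwdTemplate S S.aMax l v t₀) := by
  obtain ⟨hn, hT⟩ := nice_fwdTemplate (l := l) (t₀ := t₀) hS hv0 hv
  exact ⟨hn, fwdTemplate_self, by rw [hT _ le_rfl, fwdSpeed_self hv], h,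
    fun p hp hl hd _ t ht => hp.le_fwdTemplate hS hv0 hv hl hd ht,
    fun hc _ t ht hL => by rw [hT t ht, hc t ht hL],
    fun _ => exists_le_fwdTemplate hS hv _⟩

lemma fwdSpec_merge (hS : S.Valid) (hv0 : 0 ≤ v) (hv : v ≤ S.vMax) {u : ℝ → ℝ} (hu : Nice S u)
    {tm tp : ℝ} (h : IsFwdMerge S S.aMin S.aMax l v t₀ u tm tp) :
    FwdSpec S l v t₀ (some u) (glue tm (fwdTemplate S S.aMax l v t₀)
      (glue tp (fwdMergeSeg S S.aMin S.aMax l v t₀ tm) u)) := by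
  obtain ⟨hn, hTd⟩ := nice_fwdTemplate (l := l) (t₀ := t₀) hS hv0 hv
  obtain ⟨h0m, hmp, hbT, hbs, htp, hsp⟩ := h
  have hTs : fwdTemplate S S.aMax l v t₀ t₀ = l := fwdTemplate_self
  have hle : ∀ p, Kin S p → p t₀ ≤ l → deriv p t₀ ≤ v → ∀ t, t₀ ≤ t →
    p t ≤ fwdTemplate S S.aMax l v t₀ t := fun p hp hl hd t ht =>
      hp.le_fwdTemplate hS hv0 hv hl hd ht
  have hVle : ∀ t, fwdSpeed S S.aMax v t₀ t ≤ S.vMax := fun t => fwdSpeed_le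
  have hVs := fwdSpeed_self (t₀ := t₀) hv
  have hdef : fwdMergeSeg S S.aMin S.aMax l v t₀ tm = quad
    (fwdTemplate S S.aMax l v t₀ tm) (fwdSpeed S S.aMax v t₀ tm) S.aMin tm := rfl
  rw [hdef] at hbs htp ⊢
  have ha := hS.aMin_neg
  have ha' := hS.aMax_pos
  have huk := hu.kin
  obtain ⟨wT, aT, hmT, hBT⟩ := hn
  obtain ⟨wu, au, hmu, hBu⟩ := hu
  rw [hmT.deriv_eq] at hTd
  rw [hmu.deriv_eq] at hsp
  set T := fwdTemplate S S.aMax l v t₀ with hT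
  set V := fwdSpeed S S.aMax v t₀ with hV
  set seg := quad (T tm) (V tm) S.aMin tm with hseg
  have hin := (motion_quad (T tm) (V tm) S.aMin tm).glue hmu (c := tp) htp hsp
  have e1 : T tm = glue tp seg u tm := by rw [glue_left _ _ hmp, hseg, quad_self]
  have e2 : wT tm = glue tp (fun t => V tm + S.aMin * (t - tm)) wu tm := by
    rw [glue_left _ _ hmp, hTd tm h0m]; simp
  have hm : Motion (glue tm T (glue tp seg u)) _ _ := hmT.glue hin e1 e2
  have hB : Bounded S (glue tm wT (glue tp (fun t => V tm + S.aMin * (t - tm)) wu)) (fun t =>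
      if t < tm then aT t else if t < tp then S.aMin else au t) := by
    intro t
    rcases lt_or_ge t tm with h1 | h1
    · simpa [glue, h1, h1.le] using hBT t
    · rw [glue_right h1 e2]
      rcases lt_or_ge t tp with h2 | h2
      · rw [glue_left _ _ h2.le]
        simp only [h1.not_gt, h2, if_true, if_false]
        refine ⟨⟨?_, ?_⟩, le_rfl, by linarith⟩
        · have : 0 ≤ V tm + S.aMin * (tp - tm) := hsp ▸ (hBu tp).1.1
          nlinarith
        · nlinarith [hVle tm]
      · rw [glue_right h2 hsp]
        simpa [h1.not_gt, h2.not_gt] using hBu t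
  have hnice : Nice S (glue tm T (glue tp seg u)) := ⟨_, _, hm, hB⟩
  have hfT : ∀ t, t ≤ tm → glue tm T (glue tp seg u) t = T t := fun t ht => glue_left _ _ ht
  have hfs : ∀ t, tm ≤ t → t ≤ tp → glue tm T (glue tp seg u) t = seg t := fun t h1 h2 => by
    rw [glue_right h1 e1, glue_left _ _ h2]
  have hfu : ∀ t, tp ≤ t → glue tm T (glue tp seg u) t = u t := fun t h2 => by
    rw [glue_right (hmp.trans h2) e1, glue_right h2 htp]
  refine ⟨hnice, ?_, ?_, ?_, ?_, ?_, ?_⟩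
  · rw [hfT _ h0m, hTs]
  · rw [hm.deriv_eq, glue_left _ _ h0m, hTd _ le_rfl, hVs]
  · rintro _ ⟨⟩ t ht
    rcases le_total t tm with h1 | h1
    · rw [hfT t h1]; exact hbT t ht h1
    · rcases le_total t tp with h2 | h2
      · rw [hfs t h1 h2]; exact hbs t h1
      · rw [hfu t h2]
  · intro p hp hl hd hpu t ht
    have hpu := hpu u rfl
    rcases le_total t tm with h1 | h1
    · rw [hfT t h1]; exact hle p hp hl hd t ht
    · rcases le_total t tp with h2 | h2
      · rw [hfs t h1 h2]
        refine hp.le_quad_of_endpoints (a := tm) (b := tp) ?_ ?_ h1 h2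
        · rw [quad_self]; exact hle p hp hl hd tm h0m
        · exact (hpu tp (h0m.trans hmp)).trans htp.ge
      · rw [hfu t h2]; exact hpu t ht
  · intro hc hcu t ht hL
    have hcu := hcu u rfl
    rw [hmu.deriv_eq] at hcu
    rw [hm.deriv_eq]
    rcases le_or_gt t tm with h1 | h1
    · rw [hfT t h1] at hL
      rw [glue_left _ _ h1, hTd t ht]
      exact hc t ht hL
    · rw [glue_right h1.le e2]
      rcases le_total t tp with h2 | h2
      -- Reaching `L` on the parabola after `tm` would put `u` beyond `L` at `tp`, where `u` runs at
      -- `vMax`; but the tangent parabola has slowed below `vMax` by then.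
      · exfalso
        have h3 := hL.trans (hnice.kin.mono h2)
        rw [hfu tp le_rfl] at h3
        have h4 := hcu tp h3
        have : S.aMin * (tp - tm) < 0 := mul_neg_of_neg_of_pos ha (by linarith)
        linarith [hVle tm]
      · rw [hfu t h2] at hL
        rw [glue_right h2 hsp, hcu t hL]
  · intro hr
    obtain ⟨t, ht⟩ := hr u rfl
    refine ⟨max t tp, ?_⟩
    rw [hfu _ (le_max_right _ _)]
    exact ht.trans (huk.mono (le_max_left _ _))

lemma forwardShooting_spec (hS : S.Valid) (hv0 : 0 ≤ v) (hv : v ≤ S.vMax) {ub : Option (ℝ → ℝ)}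
    (hub : ∀ u ∈ ub, Nice S u) {f : ℝ → ℝ}
    (h : forwardShooting S S.aMin S.aMax l v t₀ ub = some f) : FwdSpec S l v t₀ ub f := by
  cases ub with
  | none =>
    simp only [forwardShooting, Option.some.injEq] at h
    subst h
    exact fwdSpec_template hS hv0 hv (by simp)
  | some u =>
    have hu := hub u rfl
    rw [forwardShooting] at h
    split_ifs at h with h1 h2
    · rw [Option.some.injEq] at h
      subst h
      exact fwdSpec_merge hS hv0 hv hu h2.choose_spec
    · rw [Option.some.injEq] at h
      subst h
      refine fwdSpec_template hS hv0 hv ?_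
      rintro _ ⟨⟩ t ht
      by_contra hcon
      push Not at hcon
      exact h2 (exists_isFwdMerge hS hv0 hv hu.kin h1 ht hcon)

/-- Immediate hardest braking stays below any feasible trajectory with the same initial state, so
the failing case is excluded. -/
lemma exists_forwardShooting_eq_some {ub : Option (ℝ → ℝ)} {p : ℝ → ℝ} (hp : Kin S p)
    (hl : p t₀ = l) (hd : deriv p t₀ = v) (hpu : ∀ u ∈ ub, ∀ t, t₀ ≤ t → p t ≤ u t) :
    ∃ f, forwardShooting S S.aMin S.aMax l v t₀ ub = some f := by
  cases ub with
  | none => exact ⟨_, rfl⟩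
  | some u =>
    rw [forwardShooting]
    split_ifs with h1
    · exact ⟨_, rfl⟩
    · exact ⟨_, rfl⟩
    · exfalso
      refine h1 fun t ht => ?_
      have := hp.quad_aMin_le ht
      rw [hl, hd] at this
      exact this.trans (hpu u rfl t ht)

end

/-! ### The backward template -/

section Template

variable {S : Setting} {l v t₀ : ℝ}

lemma bwdTemplate_self {a : ℝ} (ha : 0 < a) (hv : 0 ≤ v) : bwdTemplate a l v t₀ t₀ = l := by
  have : 0 ≤ v / a := div_nonneg hv ha.le
  rw [bwdTemplate, if_pos (by linarith), quad_self]

lemma bwdSpeed_self {a : ℝ} (hv : 0 ≤ v) : bwdSpeed a v t₀ t₀ = v := by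
  simp [bwdSpeed, hv]

lemma bwdSpeed_nonneg {a t : ℝ} : 0 ≤ bwdSpeed a v t₀ t := le_max_left _ _

lemma bwdSpeed_le {a t : ℝ} (ha : 0 ≤ a) (hv : 0 ≤ v) (ht : t ≤ t₀) : bwdSpeed a v t₀ t ≤ v :=
  max_le hv (by linarith [mul_nonneg ha (sub_nonneg.2 ht)])

lemma motion_bwdTemplate {a : ℝ} (ha : 0 < a) :
    ∃ acc, Motion (bwdTemplate a l v t₀) (bwdSpeed a v t₀) acc ∧
      ∀ t, 0 ≤ acc t ∧ acc t ≤ a := by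
  set c := t₀ - v / a with hc
  have hspeed : v + a * (c - t₀) = 0 := by rw [hc]; field_simp; ring
  have hpos : quad l v a t₀ c = l - v ^ 2 / (2 * a) := by
    rw [quad, hc]; field_simp; ring
  have hm := (motion_quad (l - v ^ 2 / (2 * a)) 0 0 c).glue (motion_quad l v a t₀) (c := c)
    (by rw [hpos, quad_self]) (by simp [hspeed])
  have e1 : glue c (quad (l - v ^ 2 / (2 * a)) 0 0 c) (quad l v a t₀) = bwdTemplate a l v t₀ := by
    funext t
    rcases lt_or_ge t c with h | h
    · rw [glue_left _ _ h.le, bwdTemplate, if_neg (by rw [← hc]; exact h.not_ge)]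
      simp [quad]
    · rw [glue_right h (by rw [hpos, quad_self]), bwdTemplate, if_pos h]
  have e2 : glue c (fun t => 0 + 0 * (t - c)) (fun t => v + a * (t - t₀)) = bwdSpeed a v t₀ := by
    funext t
    rcases le_total t c with h | h
    · rw [glue_left _ _ h, bwdSpeed, max_eq_left]
      · simp
      · have : a * (t - t₀) ≤ a * (c - t₀) := by gcongr
        linarith
    · rw [glue_right h (by simp [hspeed]), bwdSpeed, max_eq_right]
      · ring
      · have : a * (c - t₀) ≤ a * (t - t₀) := by gcongr
        linarith
  rw [e1, e2] at hm
  refine ⟨_, hm, fun t => ?_⟩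
  split_ifs <;> simp [ha.le]

lemma monotone_bwdTemplate {a : ℝ} (ha : 0 < a) : Monotone (bwdTemplate a l v t₀) := by
  obtain ⟨_, hm, -⟩ := motion_bwdTemplate (l := l) (v := v) (t₀ := t₀) ha
  refine monotone_of_deriv_nonneg (fun t => (hm.hasDerivAt t).differentiableAt) fun t => ?_
  rw [hm.deriv_eq]
  exact bwdSpeed_nonneg

/-- The standstill of the template is at `L - vMax² / (2 aMax)`; this is the second use of `L_ge`.
-/
lemma bwdTemplate_nonneg (hS : S.Valid) (t : ℝ) :
    0 ≤ bwdTemplate S.aMax S.L S.vMax t₀ t := by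
  have h1 : bwdTemplate S.aMax S.L S.vMax t₀ (min t (t₀ - S.vMax / S.aMax - 1)) =
      S.L - S.vMax ^ 2 / (2 * S.aMax) := by
    rw [bwdTemplate, if_neg]
    have := min_le_right t (t₀ - S.vMax / S.aMax - 1)
    linarith
  have h2 := monotone_bwdTemplate (l := S.L) (v := S.vMax) (t₀ := t₀) hS.aMax_pos
    (min_le_left t (t₀ - S.vMax / S.aMax - 1))
  linarith [hS.L_ge]

lemma bwdTemplate_anti {a t₀' : ℝ} (ha : 0 < a) (h : t₀ ≤ t₀') (t : ℝ) :
    bwdTemplate a l v t₀' t ≤ bwdTemplate a l v t₀ t := by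
  have e : bwdTemplate a l v t₀' t = bwdTemplate a l v t₀ (t - (t₀' - t₀)) := by
    have h1 : t - (t₀' - t₀) - t₀ = t - t₀' := by ring
    have h2 : t₀ - v / a ≤ t - (t₀' - t₀) ↔ t₀' - v / a ≤ t := by
      constructor <;> intro h <;> linarith
    simp only [bwdTemplate, quad, h1, h2]
  rw [e]
  exact monotone_bwdTemplate ha (by linarith)

/-- A feasible trajectory that is at `l` with speed `v` at time `t₀` or later stays below the
backward template from `(l, v, t₀)`. -/
lemma Kin.le_bwdTemplate (hS : S.Valid) {p : ℝ → ℝ} (hp : Kin S p) {r : ℝ}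
    (hl : p r = l) (hd : deriv p r = v) (hr : t₀ ≤ r) {t : ℝ} (ht : t ≤ t₀) :
    p t ≤ bwdTemplate S.aMax l v t₀ t := by
  refine le_trans ?_ (bwdTemplate_anti hS.aMax_pos hr t)
  obtain ⟨_, hm, -⟩ := motion_bwdTemplate (l := l) (v := v) (t₀ := r) hS.aMax_pos
  have := sub_le_sub_of_deriv_le (ht.trans hr) (fun x _ => hm.hasDerivAt x)
    (fun x _ => hp.hasDerivAt x) (fun x hx => max_le (hp.nonneg x) (by
      linarith [hp.upper hx.2]))
  rw [bwdTemplate_self hS.aMax_pos (hd ▸ hp.nonneg r), hl] at this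
  linarith

end Template

section

variable {S : Setting} {f : ℝ → ℝ} {t₀ t₁ : ℝ}

/-! ### Existence of the backward merging segment -/

/-- Time-reversed analogue of `exists_isFwdMerge`: the attachment time moves back from `t₀`, hence
the parameter `-m` in `H`. Attachment at `t₀` is admissible, since `f`, being past `L` at `t₀` and
no faster than `vMax`, is ahead of the parabola. The competitor `p` matters only for a contact at
`t₁`. -/
lemma exists_isBwdMerge (hS : S.Valid) (hf : Kin S f) (hf0 : f t₁ = 0) (h10 : t₁ < t₀)
    (hfL : S.L < f t₀) {p : ℝ → ℝ} (hp : Kin S p) (hp0 : p t₁ = 0)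
    (hpd : deriv p t₁ = deriv f t₁)
    (hpT : ∀ t, t ≤ t₀ → p t ≤ bwdTemplate S.aMax S.L S.vMax t₀ t) :
    ∃ m : ℝ × ℝ, IsBwdMerge S.aMin S.aMax S.L S.vMax t₀ t₁ f m.1 m.2 := by
  have ha := hS.aMin_neg
  obtain ⟨acc, hm, -⟩ := motion_bwdTemplate (l := S.L) (v := S.vMax) (t₀ := t₀) hS.aMax_pos
  have hTs : bwdTemplate S.aMax S.L S.vMax t₀ t₀ = S.L :=
    bwdTemplate_self hS.aMax_pos hS.vMax_pos.le
  have hVs : bwdSpeed S.aMax S.vMax t₀ t₀ = S.vMax := bwdSpeed_self hS.vMax_pos.le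
  have hT0 : ∀ t, 0 ≤ bwdTemplate S.aMax S.L S.vMax t₀ t := bwdTemplate_nonneg hS
  have hdef : ∀ tm t, bwdMergeSeg S.aMin S.aMax S.L S.vMax t₀ tm t = quad
    (bwdTemplate S.aMax S.L S.vMax t₀ tm) (bwdSpeed S.aMax S.vMax t₀ tm) S.aMin tm t :=
      fun _ _ => rfl
  simp only [IsBwdMerge, hdef]
  clear hdef
  set T := bwdTemplate S.aMax S.L S.vMax t₀ with hT
  set V := bwdSpeed S.aMax S.vMax t₀ with hV
  have hTc : Continuous T := continuous_iff_continuousAt.2 fun t => (hm.hasDerivAt t).continuousAt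
  have hVc := hm.cont
  let seg : ℝ → ℝ → ℝ := fun m => quad (T m) (V m) S.aMin m
  have hsm : ∀ m, seg m m = T m := fun m => by simp [seg]
  let H : ℝ × ℝ → ℝ := fun x => glue (-x.1) (seg (-x.1)) T x.2 - f x.2
  have hH : Continuous H := by
    refine Continuous.sub ?_ (hf.continuous.comp continuous_snd)
    refine Continuous.if_le ?_ (hTc.comp continuous_snd) continuous_snd continuous_fst.neg ?_
    · simp only [seg, quad]; fun_prop
    · rintro ⟨x, y⟩ hxy
      simp only at hxy
      simp [seg, hxy]
  have hlow : ∀ t, t ≤ t₀ → S.L - S.vMax * (t₀ - t) < f t := fun t ht => by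
    linarith [hf.le_cruise ht]
  have hstart : ∀ t ∈ Icc t₁ t₀, H (-t₀, t) ≤ 0 := fun t ht => by
    have h1 := hlow t ht.2
    simp only [H, neg_neg]
    rw [glue_left _ _ ht.2]
    simp only [seg, quad, hTs, hVs]
    nlinarith [sq_nonneg (t - t₀)]
  obtain ⟨m, hm1, hm0, c, hc1, hcm, hbelow, hcon⟩ : ∃ m, t₁ ≤ m ∧ m ≤ t₀ ∧ ∃ c, t₁ ≤ c ∧ c ≤ m ∧
      (∀ t, t₁ ≤ t → t ≤ t₀ → glue m (seg m) T t ≤ f t) ∧ glue m (seg m) T c = f c := by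
    -- If even attachment at `t₁` is admissible, the contact is at `t₁` itself: there `f` is `0` and
    -- the template is nonnegative.
    by_cases hr : ∃ r ∈ Icc t₁ t₀, 0 < H (-t₁, r)
    · obtain ⟨r, hrK, hr⟩ := hr
      obtain ⟨m, ⟨hm0, hmr⟩, c, ⟨hc1, hc0⟩, hle, hmc, hnear⟩ := exists_contact hH
        (isCompact_Icc (a := t₁) (b := t₀)) (neg_le_neg h10.le) hstart hrK hr
      refine ⟨-m, by linarith, by linarith, c, hc1, ?_, fun t ht1 ht0 => ?_, ?_⟩
      · by_contra hcm
        push Not at hcm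
        obtain ⟨m', hm', t, ht, htc, hpos⟩ := hnear (c + m) (by linarith)
        have htm : -m < t := by linarith [neg_abs_le (t - c)]
        have h1 := hle t ht
        simp only [H] at h1 hpos
        rw [glue_right htm.le (hsm _)] at h1
        rw [glue_right (by linarith [hm'.1]) (hsm _)] at hpos
        linarith
      · have := hle t ⟨ht1, ht0⟩
        simp only [H] at this
        linarith
      · simp only [H] at hmc
        linarith
    · push Not at hr
      have hb : ∀ t, t₁ ≤ t → t ≤ t₀ → glue t₁ (seg t₁) T t ≤ f t := fun t h1 h0 => by
        have := hr t ⟨h1, h0⟩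
        simp only [H, neg_neg] at this
        linarith
      refine ⟨t₁, le_rfl, h10.le, t₁, le_rfl, le_rfl, hb, ?_⟩
      refine le_antisymm (hb t₁ le_rfl h10.le) ?_
      rw [glue_left _ _ le_rfl, hsm, hf0]
      exact hT0 t₁
  have hc0 : c < t₀ := by
    rcases (hcm.trans hm0).eq_or_lt with h | h
    · exfalso
      obtain rfl : m = c := le_antisymm (h ▸ hm0) hcm
      rw [glue_left _ _ le_rfl, hsm, h, hTs] at hcon
      linarith
    · exact h
  have hder : HasDerivAt (glue m (seg m) T) (V m + S.aMin * (c - m)) c := by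
    have := hasDerivAt_glue (f := seg m) (g := T) (c := m)
      (w := fun t => V m + S.aMin * (t - m)) (z := V) (fun t _ => hasDerivAt_quad _ _ _ _ t)
      (fun t _ => hm.hasDerivAt t) (hsm m) (by simp) c
    rwa [glue_left _ _ hcm] at this
  have hspeed : V m + S.aMin * (c - m) = deriv f c := by
    rcases hc1.eq_or_lt with h | h
    · subst h
      refine le_antisymm (deriv_le_deriv_of_touch hc0 hder (hf.hasDerivAt t₁) hcon hbelow) ?_
      -- At `t₁`, `p` agrees with `f` in location and speed, and it lies below the path. So the path
      -- starts no slower than `f`, which is the missing inequality.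
      rw [← hpd]
      refine deriv_le_deriv_of_touch hc0 (hp.hasDerivAt t₁) hder (by rw [hp0, hcon, hf0])
        fun t ht1 ht0 => ?_
      rcases le_total t m with h | h
      · rw [glue_left _ _ h]
        refine hp.le_quad_of_endpoints (a := t₁) (b := m) ?_ ?_ ht1 h
        · rw [glue_left _ _ hcm] at hcon
          exact (hp0.trans (hf0.symm.trans hcon.symm)).le
        · rw [quad_self]; exact hpT m hm0
      · rw [glue_right h (hsm m)]
        exact hpT t ht0
    · exact deriv_eq_deriv_of_touch h hc0 hder (hf.hasDerivAt c) hcon hbelow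
  refine ⟨(m, c), hc1, hcm, hm0, fun t htm ht => ?_, fun t ht htm => ?_, ?_, hspeed⟩
  · have := hbelow t (hm1.trans htm) ht
    rwa [glue_right htm (hsm m)] at this
  · have := hbelow t ht (htm.trans hm0)
    rwa [glue_left _ _ htm] at this
  · rw [← hcon, glue_left _ _ hcm]

/-! ### Backward shooting -/

/-- The properties of the backward shooting trajectory `g` from `(L, vMax, t₀)` to `f`, a section
starting at `t₁`. -/
structure BwdSpec (S : Setting) (t₀ t₁ : ℝ) (f g : ℝ → ℝ) : Prop where
  nice : Nice S g
  start : g t₁ = f t₁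
  start_speed : deriv g t₁ = deriv f t₁
  below : ∀ t, t₁ ≤ t → g t ≤ f t
  hit : g t₀ = S.L
  cruise : ∀ t, t₁ ≤ t → S.L ≤ g t → deriv g t = S.vMax
  greatest : ∀ p, Kin S p → (∀ t, t₁ ≤ t → p t ≤ f t) →
    (∀ t, t ≤ t₀ → p t ≤ bwdTemplate S.aMax S.L S.vMax t₀ t) → ∀ t, t₁ ≤ t → p t ≤ g t

lemma bwdSpec_merge (hS : S.Valid) (hf : Nice S f)
    (hcr : ∀ t, S.L ≤ f t → deriv f t = S.vMax) {tm tp : ℝ}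
    (h : IsBwdMerge S.aMin S.aMax S.L S.vMax t₀ t₁ f tm tp) {aux : ℝ → ℝ}
    (haux : FwdSpec S S.L S.vMax t₀ (some f) aux) :
    BwdSpec S t₀ t₁ f (glue tp f (glue tm (bwdMergeSeg S.aMin S.aMax S.L S.vMax t₀ tm)
      (glue t₀ (bwdTemplate S.aMax S.L S.vMax t₀) aux))) := by
  have ha := hS.aMin_neg
  have ha' := hS.aMax_pos
  obtain ⟨h1p, hpm, hm0, hbT, hbs, htp, hsp⟩ := h
  obtain ⟨acc, hmT, hacc⟩ := motion_bwdTemplate (l := S.L) (v := S.vMax) (t₀ := t₀) hS.aMax_pos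
  have hTs : bwdTemplate S.aMax S.L S.vMax t₀ t₀ = S.L :=
    bwdTemplate_self hS.aMax_pos hS.vMax_pos.le
  have hVs : bwdSpeed S.aMax S.vMax t₀ t₀ = S.vMax := bwdSpeed_self hS.vMax_pos.le
  have hV0 : ∀ t, 0 ≤ bwdSpeed S.aMax S.vMax t₀ t := fun t => bwdSpeed_nonneg
  have hVle : ∀ t, t ≤ t₀ → bwdSpeed S.aMax S.vMax t₀ t ≤ S.vMax := fun t ht =>
    bwdSpeed_le ha'.le hS.vMax_pos.le ht
  have hcaux := haux.cruise
    (fun t ht _ => min_eq_left (by linarith [mul_nonneg ha'.le (sub_nonneg.2 ht)]))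
    (by rintro _ ⟨⟩; exact hcr)
  have hdef : bwdMergeSeg S.aMin S.aMax S.L S.vMax t₀ tm = quad
    (bwdTemplate S.aMax S.L S.vMax t₀ tm) (bwdSpeed S.aMax S.vMax t₀ tm) S.aMin tm := rfl
  rw [hdef] at hbs htp ⊢
  clear hdef
  obtain ⟨wx, ax, hmx, hBx⟩ := haux.nice
  have hxs := haux.start_speed
  obtain ⟨wf, af, hmf, hBf⟩ := hf
  rw [hmf.deriv_eq] at hsp hcr
  rw [hmx.deriv_eq] at hxs hcaux
  have hxs' : aux t₀ = S.L := haux.start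
  set T := bwdTemplate S.aMax S.L S.vMax t₀ with hT
  set V := bwdSpeed S.aMax S.vMax t₀ with hV
  set seg := quad (T tm) (V tm) S.aMin tm with hseg
  set wseg : ℝ → ℝ := fun t => V tm + S.aMin * (t - tm) with hwseg
  have a1 : T t₀ = aux t₀ := by rw [hTs, hxs']
  have a2 : V t₀ = wx t₀ := by rw [hVs, hxs]
  have m1 := hmT.glue hmx a1 a2
  have b1 : seg tm = glue t₀ T aux tm := by rw [glue_left _ _ hm0, hseg, quad_self]
  have b2 : wseg tm = glue t₀ V wx tm := by rw [glue_left _ _ hm0, hwseg]; simp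
  have m2 : Motion (glue tm seg (glue t₀ T aux)) (glue tm wseg (glue t₀ V wx)) _ :=
    (motion_quad (T tm) (V tm) S.aMin tm).glue m1 b1 b2
  have c1 : f tp = glue tm seg (glue t₀ T aux) tp := by rw [glue_left _ _ hpm, htp]
  have c2 : wf tp = glue tm wseg (glue t₀ V wx) tp := by rw [glue_left _ _ hpm, ← hsp]
  have hm : Motion (glue tp f (glue tm seg (glue t₀ T aux)))
    (glue tp wf (glue tm wseg (glue t₀ V wx))) _ := hmf.glue m2 c1 c2
  set g := glue tp f (glue tm seg (glue t₀ T aux)) with hg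
  set wg := glue tp wf (glue tm wseg (glue t₀ V wx)) with hwg
  have hgf : ∀ t, t ≤ tp → g t = f t ∧ wg t = wf t := fun t ht =>
    ⟨glue_left _ _ ht, glue_left _ _ ht⟩
  have hgs : ∀ t, tp ≤ t → t ≤ tm → g t = seg t ∧ wg t = wseg t := fun t h1 h2 => by
    rw [hg, hwg, glue_right h1 c1, glue_left _ _ h2, glue_right h1 c2, glue_left _ _ h2]
    exact ⟨rfl, rfl⟩
  have hgT : ∀ t, tm ≤ t → t ≤ t₀ → g t = T t ∧ wg t = V t := fun t h1 h2 => by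
    rw [hg, hwg, glue_right (hpm.trans h1) c1, glue_right h1 b1, glue_left _ _ h2,
      glue_right (hpm.trans h1) c2, glue_right h1 b2, glue_left _ _ h2]
    exact ⟨rfl, rfl⟩
  have hgx : ∀ t, t₀ ≤ t → g t = aux t ∧ wg t = wx t := fun t h1 => by
    rw [hg, hwg, glue_right ((hpm.trans hm0).trans h1) c1, glue_right (hm0.trans h1) b1,
      glue_right h1 a1, glue_right ((hpm.trans hm0).trans h1) c2, glue_right (hm0.trans h1) b2,
      glue_right h1 a2]
    exact ⟨rfl, rfl⟩
  have hsegle : ∀ t, tp ≤ t → t ≤ tm → V tm ≤ wseg t ∧ wseg t ≤ wf tp := fun t h1 h2 => by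
    rw [← hsp]
    constructor <;> simp only [hwseg] <;> nlinarith
  have hV : 0 < S.vMax := hS.vMax_pos
  have hnice : Nice S g := by
    refine ⟨_, _, hm, fun t => ?_⟩
    rcases lt_or_ge t tp with h1 | h1
    · rw [(hgf t h1.le).2]
      simpa [h1] using hBf t
    rcases lt_or_ge t tm with h2 | h2
    · rw [(hgs t h1 h2.le).2]
      obtain ⟨h3, h4⟩ := hsegle t h1 h2.le
      simp only [h1.not_gt, h2, if_true, if_false]
      exact ⟨⟨(hV0 tm).trans h3, h4.trans (hBf tp).1.2⟩, le_rfl, by linarith⟩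
    rcases lt_or_ge t t₀ with h3 | h3
    · rw [(hgT t h2 h3.le).2]
      simp only [h1.not_gt, h2.not_gt, h3, if_true, if_false]
      exact ⟨⟨hV0 t, hVle t h3.le⟩, by linarith [(hacc t).1], (hacc t).2⟩
    · rw [(hgx t h3).2]
      simpa [h1.not_gt, h2.not_gt, h3.not_gt] using hBx t
  refine ⟨hnice, (hgf t₁ h1p).1, ?_, fun t ht => ?_, ?_, fun t ht hL => ?_, fun p hp hpf hpT t ht => ?_⟩
  · rw [hm.deriv_eq, hmf.deriv_eq, (hgf t₁ h1p).2]
  · rcases le_total t tp with h1 | h1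
    · rw [(hgf t h1).1]
    rcases le_total t tm with h2 | h2
    · rw [(hgs t h1 h2).1]; exact hbs t ht h2
    rcases le_total t t₀ with h3 | h3
    · rw [(hgT t h2 h3).1]; exact hbT t h2 h3
    · rw [(hgx t h3).1]; exact haux.below f rfl t h3
  · rw [(hgx t₀ le_rfl).1, hxs']
  · rw [hm.deriv_eq]
    rcases le_or_gt t tp with h1 | h1
    · rw [(hgf t h1).1] at hL
      rw [(hgf t h1).2, hcr t hL]
    -- A monotone template at `L` before `t₀` would be constant up to `t₀`, contradicting its speed
    -- `vMax > 0` there.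
    have hTlt : ∀ r, tm ≤ r → r < t₀ → S.L ≤ T r → False := fun r hr1 hr2 hLr => by
      have h4 : V r < S.vMax := max_lt hV (by nlinarith)
      have h5 : 0 < V t₀ := by rw [hVs]; exact hV
      have hd := hmT.hasDerivAt t₀
      have hmono := monotone_bwdTemplate (l := S.L) (v := S.vMax) (t₀ := t₀) hS.aMax_pos
      have : V t₀ ≤ 0 := by
        have hneg : ∀ x, r ≤ x → x ≤ t₀ → T x = S.L := fun x hx1 hx2 =>
          le_antisymm (hTs ▸ hmono hx2) (hLr.trans (hmono hx1))
        have h6 : HasDerivWithinAt T 0 (Icc r t₀) t₀ :=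
          (hasDerivWithinAt_const t₀ (Icc r t₀) S.L).congr (fun x hx => hneg x hx.1 hx.2) hTs
        exact ((uniqueDiffOn_Icc hr2 t₀ (right_mem_Icc.2 hr2.le)).eq_deriv _
          hd.hasDerivWithinAt h6).le
      linarith
    rcases le_or_gt t tm with h2 | h2
    · exfalso
      have h3 := hL.trans (hnice.kin.mono h2)
      rw [(hgT tm le_rfl hm0).1] at h3
      rcases hm0.eq_or_lt with h4 | h4
      -- If the parabola is attached at `t₀`, with speed `vMax`, then at the earlier time `tp` it is
      -- faster than `vMax`, and so is `f` by tangency.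
      · have h5 : S.aMin * (tp - tm) > 0 := mul_pos_of_neg_of_neg ha (by linarith)
        have h6 := (hBf tp).1.2
        rw [← hsp, h4, hVs] at h6
        rw [h4] at h5
        linarith
      · exact hTlt tm le_rfl h4 h3
    rcases lt_or_ge t t₀ with h3 | h3
    · rw [(hgT t h2.le h3.le).1] at hL
      exact (hTlt t h2.le h3 hL).elim
    · rw [(hgx t h3).1] at hL
      rw [(hgx t h3).2, hcaux t h3 hL]
  · rcases le_total t tp with h1 | h1
    · rw [(hgf t h1).1]; exact hpf t ht
    rcases le_total t tm with h2 | h2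
    · rw [(hgs t h1 h2).1]
      refine hp.le_quad_of_endpoints (a := tp) (b := tm) ?_ ?_ h1 h2
      · exact (hpf tp h1p).trans htp.ge
      · rw [quad_self]; exact hpT tm hm0
    rcases le_total t t₀ with h3 | h3
    · rw [(hgT t h2 h3).1]; exact hpT t h3
    · rw [(hgx t h3).1]
      refine haux.greatest p hp ((hpT t₀ le_rfl).trans hTs.le) (hp.le_vMax t₀) ?_ t h3
      rintro _ ⟨⟩ x hx
      exact hpf x (((h1p.trans hpm).trans hm0).trans hx)

lemma backwardShooting_spec (hS : S.Valid) (hf : Nice S f)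
    (hcr : ∀ t, S.L ≤ f t → deriv f t = S.vMax) {b : ℝ × (ℝ → ℝ)}
    (h : backwardShooting S S.aMin S.aMax S.aMin S.aMax S.L S.vMax t₀ t₁ f = some b) :
    BwdSpec S t₀ t₁ f b.2 := by
  rw [backwardShooting] at h
  split_ifs at h with h1
  obtain ⟨aux, haux, rfl⟩ := Option.map_eq_some_iff.1 h
  exact bwdSpec_merge hS hf hcr h1.choose_spec (forwardShooting_spec hS hS.vMax_pos.le le_rfl
    (by rintro _ ⟨⟩; exact hf) haux)

/-- Backward shooting succeeds, with a merging point of nonnegative location, as soon as some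
feasible trajectory passes below `f` and the backward template. -/
lemma exists_backwardShooting_eq_some (hS : S.Valid) (hf : Nice S f) (hf0 : f t₁ = 0)
    (hcr : ∀ t, S.L ≤ f t → deriv f t = S.vMax) (h10 : t₁ < t₀)
    (hfL : S.L < f t₀) {p : ℝ → ℝ} (hp : Kin S p) (hp0 : p t₁ = 0)
    (hpd : deriv p t₁ = deriv f t₁)
    (hpT : ∀ t, t ≤ t₀ → p t ≤ bwdTemplate S.aMax S.L S.vMax t₀ t) :
    ∃ b, backwardShooting S S.aMin S.aMax S.aMin S.aMax S.L S.vMax t₀ t₁ f = some b ∧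
      0 ≤ b.1 := by
  have hex := exists_isBwdMerge hS hf.kin hf0 h10 hfL hp hp0 hpd hpT
  obtain ⟨aux, haux⟩ : ∃ aux, forwardShooting S S.aMin S.aMax S.L S.vMax t₀ (some f) =
      some aux := by
    rw [forwardShooting]
    -- The auxiliary shooting cannot fail: from `t₀` on, `f` is past `L` and runs at `vMax`, while
    -- the braking parabola starts at `L` and is no faster.
    split_ifs with h1
    · exact ⟨_, rfl⟩
    · exact ⟨_, rfl⟩
    · exfalso
      refine h1 fun t ht => ?_
      have h2 : ∀ x ∈ Icc t₀ t, S.vMax + S.aMin * (x - t₀) ≤ deriv f x := fun x hx => by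
        rw [hcr x (hfL.le.trans (hf.kin.mono hx.1))]
        nlinarith [hS.aMin_neg, hx.1]
      have := sub_le_sub_of_deriv_le ht (fun x _ => hasDerivAt_quad S.L S.vMax S.aMin t₀ x)
        (fun x _ => hf.kin.hasDerivAt x) h2
      rw [quad_self] at this
      linarith
  rw [backwardShooting, dif_pos hex, haux]
  refine ⟨_, rfl, ?_⟩
  rw [← hf0]
  exact hf.kin.mono hex.choose_spec.1

end

/-! ### Exit times -/

/-- For a non-green `x` the infimum is attained at the first cycle start `m C ≥ x`: a green time
after `x` in an earlier cycle, which began before `x`, would make `x` green. -/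
lemma isLeast_nextGreen {S : Setting} (hS : S.Valid) {x : ℝ} (hx : x ∉ greenTimes S) :
    nextGreen S x ∈ greenTimes S ∧ x < nextGreen S x ∧
      ∀ y ∈ greenTimes S, x ≤ y → nextGreen S x ≤ y := by
  have hG := hS.G_pos
  have hC : 0 < S.G + S.R := by linarith [hS.R_nonneg]
  obtain ⟨k, hk⟩ := exists_nat_ge (x / (S.G + S.R))
  have hex : ∃ m : ℕ, x ≤ m * (S.G + S.R) := ⟨k, (div_le_iff₀ hC).1 hk⟩
  classical
  set m := Nat.find hex with hm
  have hmx : x ≤ m * (S.G + S.R) := Nat.find_spec hex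
  have hmem : (m : ℝ) * (S.G + S.R) ∈ greenTimes S := ⟨m, le_rfl, by linarith⟩
  have hleast : IsLeast {t' | t' ∈ greenTimes S ∧ x ≤ t'} (m * (S.G + S.R)) := by
    refine ⟨⟨hmem, hmx⟩, ?_⟩
    rintro y ⟨⟨j, hj1, hj2⟩, hxy⟩
    rcases lt_or_ge j m with h | h
    · have := Nat.find_min hex h
      exact absurd ⟨j, (not_le.1 this).le, hxy.trans_lt hj2⟩ hx
    · refine le_trans ?_ hj1
      gcongr
  have he : nextGreen S x = m * (S.G + S.R) := hleast.csInf_eq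
  rw [he]
  refine ⟨hmem, lt_of_le_of_ne hmx fun h => hx (h ▸ hmem), fun y hy hxy => hleast.2 ⟨hy, hxy⟩⟩

section

variable {S : Setting} {f : ℝ → ℝ}

lemma Kin.exists_eq (hf : Kin S f) {t₁ x : ℝ} (h1 : f t₁ ≤ x) (h : ∃ t, x ≤ f t) :
    ∃ t, f t = x := by
  obtain ⟨t, ht⟩ := h
  obtain ⟨y, -, hy⟩ := intermediate_value_uIcc (f := f) (a := t₁) (b := t)
    hf.continuous.continuousOn (by rw [uIcc_of_le (h1.trans ht)]; exact ⟨h1, ht⟩)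
  exact ⟨y, hy⟩

lemma Kin.map_passTime (hf : Kin S f) {t₁ x : ℝ} (h1 : f t₁ < x) (h : ∃ t, x ≤ f t) :
    f (passTime f x) = x := by
  have hb : BddBelow {t | x ≤ f t} := ⟨t₁, fun t ht => by
    by_contra hcon
    push Not at hcon
    exact absurd (hf.mono hcon.le) (h1.trans_le ht).not_ge⟩
  obtain ⟨y, hy⟩ := hf.exists_eq h1.le h
  refine le_antisymm ?_ ?_
  · rw [← hy]
    exact hf.mono (csInf_le (hy ▸ hb) (le_refl (f y)))
  · exact (isClosed_le continuous_const hf.continuous).csInf_mem h hb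

/-- Once at `L`, such a motion runs at full speed. -/
def Cruises (S : Setting) (f : ℝ → ℝ) : Prop := ∀ t, S.L ≤ f t → deriv f t = S.vMax

lemma Cruises.lt_of_lt (hS : S.Valid) (hf : Kin S f) (hc : Cruises S f) {r t : ℝ}
    (hr : S.L ≤ f r) (hrt : r < t) : S.L < f t := by
  have := sub_le_sub_of_deriv_le hrt.le (fun x _ => hasDerivAt_quad 0 S.vMax 0 r x)
    (fun x _ => hf.hasDerivAt x)
    (fun x hx => by simp [hc x (hr.trans (hf.mono hx.1))])
  simp only [quad, zero_div, zero_mul, zero_add, add_zero, sub_self, mul_zero, sub_zero] at this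
  linarith [mul_pos hS.vMax_pos (sub_pos.2 hrt)]

lemma Cruises.passTime_eq (hS : S.Valid) (hf : Kin S f) (hc : Cruises S f) {t : ℝ}
    (ht : f t = S.L) : passTime f S.L = t := by
  refine IsLeast.csInf_eq ⟨ht.ge, fun r hr => ?_⟩
  by_contra hcon
  push Not at hcon
  exact absurd ht (hc.lt_of_lt hS hf hr hcon).ne'

lemma Cruises.shadow (hS : S.Valid) (hf : Kin S f) (hc : Cruises S f) :
    Cruises S (shadow S f) := fun t ht => by
  rw [(hf.shadow t).deriv]
  refine hc _ ?_
  simp only [SignalTraj.shadow] at ht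
  linarith [hS.s_pos]

lemma Cruises.exists_le (hS : S.Valid) (hf : Kin S f) (hc : Cruises S f) (h : ∃ t, S.L ≤ f t)
    (x : ℝ) : ∃ t, x ≤ f t := by
  obtain ⟨r, hr⟩ := h
  have hV := hS.vMax_pos
  have h0 : 0 ≤ |x - S.L| / S.vMax := by positivity
  refine ⟨r + |x - S.L| / S.vMax, ?_⟩
  have := sub_le_sub_of_deriv_le (le_add_of_nonneg_right h0 : r ≤ r + |x - S.L| / S.vMax)
    (fun x _ => hasDerivAt_quad 0 S.vMax 0 r x) (fun x _ => hf.hasDerivAt x)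
    (fun x hx => by simp [hc x (hr.trans (hf.mono hx.1))])
  simp only [quad, zero_div, zero_mul, zero_add, add_zero, sub_self, mul_zero, sub_zero,
    add_sub_cancel_left, mul_div_cancel₀ _ hV.ne'] at this
  linarith [le_abs_self (x - S.L)]

/-! ### One vehicle -/

/-- The trajectory `f` is feasible for a vehicle entering at time `t₁` with speed `v` below the
bound `ub`, it exits at a green time and at full speed, and no trajectory doing the same is ever
ahead of it. -/
structure StepSpec (S : Setting) (v t₁ : ℝ) (ub : Option (ℝ → ℝ)) (f : ℝ → ℝ) : Prop where
  nice : Nice S f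
  start : f t₁ = 0
  start_speed : deriv f t₁ = v
  below : ∀ u ∈ ub, ∀ t, t₁ ≤ t → f t ≤ u t
  cruises : Cruises S f
  exit : ∃ t ∈ greenTimes S, f t = S.L
  greatest : ∀ p, Kin S p → p t₁ = 0 → deriv p t₁ = v → (∀ u ∈ ub, ∀ t, t₁ ≤ t → p t ≤ u t) →
    (∃ t ∈ greenTimes S, p t = S.L ∧ deriv p t = S.vMax) → ∀ t, t₁ ≤ t → p t ≤ f t

/-- A usable safety bound. -/
structure IsBound (S : Setting) (u : ℝ → ℝ) : Prop where
  nice : Nice S u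
  cruises : Cruises S u
  reach : ∃ t, S.L ≤ u t

variable {v t₁ : ℝ}

lemma StepSpec.isBound_shadow (hS : S.Valid) {ub : Option (ℝ → ℝ)} (h : StepSpec S v t₁ ub f) :
    IsBound S (shadow S f) := by
  have hk := h.nice.kin
  refine ⟨h.nice.shadow, h.cruises.shadow hS hk, ?_⟩
  obtain ⟨r, -, hr⟩ := h.exit
  obtain ⟨t, ht⟩ := h.cruises.exists_le hS hk ⟨r, hr.ge⟩ (S.L + S.s)
  refine ⟨t + S.τ, ?_⟩
  simp only [SignalTraj.shadow, add_sub_cancel_right]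
  linarith

lemma FwdSpec.cruises (hS : S.Valid) (hv0 : 0 ≤ v) (hv : v ≤ S.vMax) {ub : Option (ℝ → ℝ)}
    (hub : ∀ u ∈ ub, IsBound S u) (h : FwdSpec S 0 v t₁ ub f) : Cruises S f := fun t hL => by
  refine h.cruise (fun t ht hL => fwdSpeed_eq_of_L_le hS hv0 hv ht hL)
    (fun u hu => (hub u hu).cruises) t ?_ hL
  by_contra hcon
  push Not at hcon
  linarith [h.nice.kin.mono hcon.le, h.start, hS.L_pos]

lemma FwdSpec.map_passTime (hS : S.Valid) {ub : Option (ℝ → ℝ)}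
    (hub : ∀ u ∈ ub, IsBound S u) (h : FwdSpec S 0 v t₁ ub f) : f (passTime f S.L) = S.L :=
  h.nice.kin.map_passTime (h.start.trans_lt hS.L_pos) (h.reach fun u hu => (hub u hu).reach)

/-- A competitor exiting at a green time does so no earlier than the next green time, so it stays
below the backward template. -/
lemma FwdSpec.le_bwdTemplate (hS : S.Valid) (hv0 : 0 ≤ v) (hv : v ≤ S.vMax)
    {ub : Option (ℝ → ℝ)} (hub : ∀ u ∈ ub, IsBound S u) (h : FwdSpec S 0 v t₁ ub f)
    (hgreen : passTime f S.L ∉ greenTimes S) {p : ℝ → ℝ} (hp : Kin S p) (hp0 : p t₁ = 0)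
    (hpf : ∀ t, t₁ ≤ t → p t ≤ f t)
    (hpe : ∃ t ∈ greenTimes S, p t = S.L ∧ deriv p t = S.vMax) {t : ℝ}
    (ht : t ≤ nextGreen S (passTime f S.L)) :
    p t ≤ bwdTemplate S.aMax S.L S.vMax (nextGreen S (passTime f S.L)) t := by
  obtain ⟨r, hr, hrL, hrd⟩ := hpe
  have hk := h.nice.kin
  have h1r : t₁ ≤ r := by
    by_contra hcon
    push Not at hcon
    linarith [hp.mono hcon.le, hS.L_pos]
  have hle : passTime f S.L ≤ r := by
    by_contra hcon
    push Not at hcon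
    have h1 := (h.cruises hS hv0 hv hub).lt_of_lt hS hk (hrL.ge.trans (hpf r h1r)) hcon
    rw [h.map_passTime hS hub] at h1
    exact lt_irrefl _ h1
  exact hp.le_bwdTemplate hS hrL hrd ((isLeast_nextGreen hS hgreen).2.2 r hr hle) ht

lemma shStep_spec (hS : S.Valid) (hv0 : 0 ≤ v) (hv : v ≤ S.vMax) {prev : Option (ℝ → ℝ)}
    (hub : ∀ u ∈ prev.map (shadow S), IsBound S u)
    (h : shStep S S.aMin S.aMax S.aMin S.aMax v t₁ prev = some f) :
    StepSpec S v t₁ (prev.map (shadow S)) f := by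
  rw [shStep, Option.bind_eq_some_iff] at h
  obtain ⟨pf, hpf, h⟩ := h
  have hsp := forwardShooting_spec hS hv0 hv (fun u hu => (hub u hu).nice) hpf
  have hcr := hsp.cruises hS hv0 hv hub
  have hpass := hsp.map_passTime hS hub
  split_ifs at h with hg
  · obtain rfl := Option.some.inj h
    exact ⟨hsp.nice, hsp.start, hsp.start_speed, hsp.below, hcr, ⟨_, hg, hpass⟩,
      fun p hp h0 hd hpu _ => hsp.greatest p hp h0.le hd.le hpu⟩
  -- The heuristic starts the backward shooting with the speed of `pf` at `L`; since `pf` cruises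
  -- there, this speed is `vMax`.
  · rw [Option.bind_eq_some_iff, hcr _ hpass.ge] at h
    obtain ⟨b, hb, h⟩ := h
    split_ifs at h with hb0
    obtain rfl := Option.some.inj h
    have hbs := backwardShooting_spec hS hsp.nice hcr hb
    have hs0 : b.2 t₁ = 0 := hbs.start.trans hsp.start
    refine ⟨hbs.nice, hs0, hbs.start_speed.trans hsp.start_speed,
      fun u hu t ht => (hbs.below t ht).trans (hsp.below u hu t ht), fun t hL => ?_,
      ⟨_, (isLeast_nextGreen hS hg).1, hbs.hit⟩, fun p hp h0 hd hpu hpe => ?_⟩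
    · refine hbs.cruise t ?_ hL
      by_contra hcon
      push Not at hcon
      linarith [hbs.nice.kin.mono hcon.le, hS.L_pos]
    · have hpf' := hsp.greatest p hp h0.le hd.le hpu
      exact hbs.greatest p hp hpf'
        fun t ht => hsp.le_bwdTemplate hS hv0 hv hub hg hp h0 hpf' hpe ht

lemma exists_shStep_eq_some (hS : S.Valid) (hv0 : 0 ≤ v) (hv : v ≤ S.vMax)
    {prev : Option (ℝ → ℝ)} (hub : ∀ u ∈ prev.map (shadow S), IsBound S u) {p : ℝ → ℝ}
    (hp : Kin S p) (hp0 : p t₁ = 0) (hpd : deriv p t₁ = v)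
    (hpu : ∀ u ∈ prev.map (shadow S), ∀ t, t₁ ≤ t → p t ≤ u t)
    (hpe : ∃ t ∈ greenTimes S, p t = S.L ∧ deriv p t = S.vMax) :
    ∃ f, shStep S S.aMin S.aMax S.aMin S.aMax v t₁ prev = some f := by
  obtain ⟨pf, hpf⟩ := exists_forwardShooting_eq_some hp hp0 hpd hpu
  have hsp := forwardShooting_spec hS hv0 hv (fun u hu => (hub u hu).nice) hpf
  have hcr := hsp.cruises hS hv0 hv hub
  have hpass := hsp.map_passTime hS hub
  rw [shStep, hpf, Option.bind_some]
  split_ifs with hg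
  · exact ⟨_, rfl⟩
  · have hlt := (isLeast_nextGreen hS hg).2.1
    have h1 : t₁ < passTime pf S.L := by
      by_contra hcon
      push Not at hcon
      linarith [hsp.nice.kin.mono hcon, hsp.start, hS.L_pos]
    have hpf' := hsp.greatest p hp hp0.le hpd.le hpu
    obtain ⟨b, hb, hb0⟩ := exists_backwardShooting_eq_some hS hsp.nice hsp.start hcr
      (h1.trans hlt) (hcr.lt_of_lt hS hsp.nice.kin hpass.ge hlt) hp hp0
      (hpd.trans hsp.start_speed.symm)
      (fun t ht => hsp.le_bwdTemplate hS hv0 hv hub hg hp hp0 hpf' hpe ht)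
    rw [hcr _ hpass.ge, hb, Option.bind_some, if_pos hb0]
    exact ⟨_, rfl⟩

end

/-! ### All vehicles -/

section

variable {S : Setting} {N : ℕ} {v t : Fin N → ℝ}

/-- The output of the heuristic for the predecessor of vehicle `n`. -/
def shPrev (S : Setting) (v t : Fin N → ℝ) : (n : ℕ) → n < N → Option (ℝ → ℝ)
  | 0, _ => none
  | n + 1, h => shVehicle S S.aMin S.aMax S.aMin S.aMax v t n (Nat.lt_of_succ_lt h)

lemma shVehicle_spec (hS : S.Valid) (hv : ∀ n, 0 ≤ v n ∧ v n ≤ S.vMax) :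
    ∀ (n : ℕ) (h : n < N) (f : ℝ → ℝ),
      shVehicle S S.aMin S.aMax S.aMin S.aMax v t n h = some f →
      StepSpec S (v ⟨n, h⟩) (t ⟨n, h⟩) ((shPrev S v t n h).map (shadow S)) f
  | 0, h, f, hf => shStep_spec hS (hv _).1 (hv _).2 (by simp [shPrev]) hf
  | n + 1, h, f, hf => by
    rw [shVehicle, Option.bind_eq_some_iff] at hf
    obtain ⟨q, hq, hf⟩ := hf
    have ih := shVehicle_spec hS hv n (Nat.lt_of_succ_lt h) q hq
    rw [shPrev, hq]
    refine shStep_spec hS (hv _).1 (hv _).2 ?_ hf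
    rintro _ ⟨⟩
    exact ih.isBound_shadow hS

lemma exit_of_mem_feasibleFullSpeed (hS : S.Valid) {p : Fin N → ℝ → ℝ}
    (hp : p ∈ feasibleFullSpeed S v t) (n : Fin N) :
    ∃ r ∈ greenTimes S, p n r = S.L ∧ deriv (p n) r = S.vMax := by
  obtain ⟨⟨h, -⟩, hd⟩ := hp
  obtain ⟨⟨hk, h0, -⟩, -, hr, hg⟩ := h n
  exact ⟨_, hg, (kin_of_mem_kinematic hk).map_passTime (h0.trans_lt hS.L_pos) hr, hd n⟩

/-- If a full-speed feasible vector exists, then the heuristic succeeds for every vehicle and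
stays ahead of it. -/
lemma exists_shVehicle_eq_some (hS : S.Valid) (hv : ∀ n, 0 ≤ v n ∧ v n ≤ S.vMax)
    {p : Fin N → ℝ → ℝ} (hp : p ∈ feasibleFullSpeed S v t) : ∀ (n : ℕ) (h : n < N),
      ∃ f, shVehicle S S.aMin S.aMax S.aMin S.aMax v t n h = some f ∧
        ∀ x, t ⟨n, h⟩ ≤ x → p ⟨n, h⟩ x ≤ f x := by
  have key : ∀ (n : ℕ) (h : n < N) (prev : Option (ℝ → ℝ)),
      (∀ u ∈ prev.map (shadow S), IsBound S u) →
      (∀ u ∈ prev.map (shadow S), ∀ x, t ⟨n, h⟩ ≤ x → p ⟨n, h⟩ x ≤ u x) →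
      ∃ f, shStep S S.aMin S.aMax S.aMin S.aMax (v ⟨n, h⟩) (t ⟨n, h⟩) prev = some f ∧
        ∀ x, t ⟨n, h⟩ ≤ x → p ⟨n, h⟩ x ≤ f x := by
    intro n h prev hub hpu
    obtain ⟨hk, h0, hd⟩ := (hp.1.1 ⟨n, h⟩).1
    have hk := kin_of_mem_kinematic hk
    have hpe := exit_of_mem_feasibleFullSpeed hS hp ⟨n, h⟩
    obtain ⟨f, hf⟩ := exists_shStep_eq_some hS (hv _).1 (hv _).2 hub hk h0 hd hpu hpe
    exact ⟨f, hf, (shStep_spec hS (hv _).1 (hv _).2 hub hf).greatest _ hk h0 hd hpu hpe⟩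
  intro n
  induction n with
  | zero => exact fun h => key 0 h none (by simp) (by simp)
  | succ n ih =>
    intro h
    obtain ⟨q, hq, hpq⟩ := ih (Nat.lt_of_succ_lt h)
    rw [shVehicle, hq, Option.bind_some]
    refine key (n + 1) h (some q) ?_ ?_
    · rintro _ ⟨⟩
      exact (shVehicle_spec hS hv n _ q hq).isBound_shadow hS
    · rintro _ ⟨⟩ x hx
      have hsafe := hp.1.2 ⟨n, Nat.lt_of_succ_lt h⟩ ⟨n + 1, h⟩ rfl
      refine (hsafe x hx).trans (sub_le_sub_right (hpq _ ?_) _)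
      -- The induction hypothesis covers the leader only after its entry, so the delayed time `x -
      -- τ` must not precede it. At its own entry the follower is at `0`, below the leader's shadow;
      -- the leader is then at `s > 0` or beyond at the delayed time, hence has already entered.
      by_contra hcon
      push Not at hcon
      obtain ⟨hk, h0, -⟩ := (hp.1.1 ⟨n, Nat.lt_of_succ_lt h⟩).1
      obtain ⟨-, h0', -⟩ := (hp.1.1 ⟨n + 1, h⟩).1
      have h1 := hsafe _ le_rfl
      rw [h0', shadow] at h1
      have h2 := (kin_of_mem_kinematic hk).mono
        (show t ⟨n + 1, h⟩ - S.τ ≤ t ⟨n, Nat.lt_of_succ_lt h⟩ by linarith)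
      linarith [hS.s_pos]

/-- The output of the heuristic is feasible, with full-speed exits. -/
lemma mem_feasibleFullSpeed_of_shVehicle (hS : S.Valid) (hv : ∀ n, 0 ≤ v n ∧ v n ≤ S.vMax)
    {P : Fin N → ℝ → ℝ}
    (hP : ∀ n : Fin N, shVehicle S S.aMin S.aMax S.aMin S.aMax v t n n.isLt = some (P n)) :
    P ∈ feasibleFullSpeed S v t := by
  have hsp : ∀ n : Fin N, StepSpec S (v n) (t n) ((shPrev S v t n n.isLt).map (shadow S)) (P n) :=
    fun n => shVehicle_spec hS hv n n.isLt _ (hP n)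
  have hkin : ∀ n, P n ∈ kinematic S := fun n => by
    obtain ⟨w, a, hm, hb⟩ := (hsp n).nice
    exact hm.mem_kinematic hb
  have hpass : ∀ n, ∃ r ∈ greenTimes S, P n r = S.L ∧ passTime (P n) S.L = r := fun n => by
    obtain ⟨r, hr, hL⟩ := (hsp n).exit
    exact ⟨r, hr, hL, (hsp n).cruises.passTime_eq hS (hsp n).nice.kin hL⟩
  refine ⟨⟨fun n => ⟨⟨hkin n, (hsp n).start, (hsp n).start_speed⟩, hkin n, ?_⟩, ?_⟩, fun n => ?_⟩
  · obtain ⟨r, hr, hL, he⟩ := hpass n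
    exact ⟨⟨r, hL.ge⟩, he ▸ hr⟩
  · rintro m ⟨k, hk⟩ hmn x hx
    obtain rfl : (m : ℕ) + 1 = k := hmn
    refine (hsp _).below _ ?_ x hx
    simp only [shPrev]
    rw [hP m]
    rfl
  · obtain ⟨r, -, hL, he⟩ := hpass n
    rw [he]
    exact (hsp n).cruises r hL.ge

lemma shootingHeuristic_eq_some_iff {P : Fin N → ℝ → ℝ} :
    shootingHeuristic S S.aMin S.aMax S.aMin S.aMax v t = some P ↔
      ∀ n : Fin N, shVehicle S S.aMin S.aMax S.aMin S.aMax v t n n.isLt = some (P n) := by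
  rw [shootingHeuristic]
  split_ifs with h
  · rw [Option.some.injEq, funext_iff]
    exact forall_congr' fun n => ⟨fun e => by rw [← e, Option.some_get], fun e => by simp [e]⟩
  · refine ⟨fun h' => (by simp at h'), fun h' => (h fun n => by rw [h' n]; rfl).elim⟩

end

end SignalTraj

end

/-! ### The equivalence and the dominance statement. -/

theorem mainTheorem3 (S : SignalTraj.Setting)
    (hG : 0 < S.G) (hR : 0 ≤ S.R) (hvMax : 0 < S.vMax) (haMin : S.aMin < 0) (haMax : 0 < S.aMax)
    (hs : 0 < S.s) (hτ : 0 ≤ S.τ)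
    {N : ℕ} (v t : Fin N → ℝ) (hv : ∀ n, 0 ≤ v n ∧ v n ≤ S.vMax) (ht : StrictMono t)
    (hL : S.vMax ^ 2 / (2 * S.aMax) ≤ S.L) :
    ((SignalTraj.feasibleFullSpeed S v t).Nonempty ↔
      SignalTraj.shootingHeuristic S S.aMin S.aMax S.aMin S.aMax v t ≠ none) ∧
    ∀ P, SignalTraj.shootingHeuristic S S.aMin S.aMax S.aMin S.aMax v t = some P →
      ∀ p ∈ SignalTraj.feasibleFullSpeed S v t, ∀ n x, t n ≤ x → p n x ≤ P n x := by
  have hS : S.Valid := ⟨hG, hR, hvMax, haMin, haMax, hs, hτ, hL⟩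
  refine ⟨⟨fun ⟨p, hp⟩ => ?_, fun h => ?_⟩, fun P hP p hp n x hx => ?_⟩
  · choose f hf _ using SignalTraj.exists_shVehicle_eq_some hS hv hp
    rw [SignalTraj.shootingHeuristic_eq_some_iff.2 fun n => hf n n.isLt]
    exact Option.some_ne_none _
  · obtain ⟨P, hP⟩ := Option.ne_none_iff_exists'.1 h
    exact ⟨P, SignalTraj.mem_feasibleFullSpeed_of_shVehicle hS hv
      (SignalTraj.shootingHeuristic_eq_some_iff.1 hP)⟩
  · obtain ⟨f, hf, hle⟩ := SignalTraj.exists_shVehicle_eq_some hS hv hp n n.isLt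
    rw [SignalTraj.shootingHeuristic_eq_some_iff.1 hP n] at hf
    obtain rfl := Option.some.inj hf
    exact hle x hx
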